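/- Let $\mathcal H$ be a complex Hilbert space. A closed real subspace $V\subseteq\mathcal H$ is called *standard* if $V\cap iV=\{0\}$ and $V+iV$ is dense in $\mathcal H$. For a standard subspace $V$ let $S\colon V+iV\to\mathcal H$, $S(v+iw)=v-iw$ $(v,w\in V)$, be the associated antilinear operator, let $\Delta_V:=S^*S$ be the modular operator (a positive, injective, selfadjoint operator) and let $(\Delta_V^{it})_{t\in\mathbb R}$ be the corresponding unitary one-parameter group. For a closed real subspace $W\subseteq\mathcal H$ put $W^{\bot_{\mathbb R}}:=\{x\in\mathcal H : \operatorname{Re}\langle w,x\rangle=0\ \text{for all } w\in W\}$ and $W':=\{x\in\mathcal H : \operatorname{Im}\langle w,x\rangle=0\ \text{for all } w\in W\}$. **Lemma.** Let $V\subseteq\mathcal H$ be a standard subspace, let $V_1\subseteq V$ be a closed real subspace, and let $V_2:=V\cap V_1^{\bot_{\mathbb R}}$ be its orthogonal complement in $V$. Then the following are equivalent: 1. $V=V_1\oplus V_2$ is a direct sum of standard subspaces, i.e. there is an orthogonal decomposition $\mathcal H=\mathcal H_1\oplus\mathcal H_2$ into closed complex subspaces such that $V_j$ is a standard subspace of the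 Hilbert space $\mathcal H_j$ for $j=1,2$, and $V=V_1+V_2$. 2. $V_1\subseteq V_2'$; equivalently, $iV_1\bot V_2$ in $\mathcal H$ (that is, $\langle ix,y\rangle=0$ for all $x\in V_1$, $y\in V_2$). 3. $\Delta_V^{it}V_1\subseteq V_1$ for every $t\in\mathbb R$. If these conditions are satisfied and $V_1$ is also standard in $\mathcal H$, then $V_1=V$. -/

import Mathlib

open Complex
open scoped ClosedSubmodule

/-!
Modular theory of a standard subspace `V` of a complex Hilbert space `H`: the Tomita operator
`S (v + i w) = v - i w`, its adjoint, the modular operator `Δ = S* S`, and the unitary operators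
`Δ ^ (i t)`.  Standard subspaces are those of Mathlib (`StandardSubspace`), inner products are
linear in the second argument.
-/

namespace StandardSubspace

section Tomita

variable {H : Type*} [NormedAddCommGroup H] [InnerProductSpace ℂ H]

theorem smul_add_I_smul (c : ℂ) (v w : H) :
    (c.re • v - c.im • w) + I • (c.im • v + c.re • w) = c • (v + I • w) := by
  conv_rhs => rw [← Complex.re_add_im c]
  simp only [← Complex.coe_smul]
  match_scalars <;>
    first
    | ring1
    | linear_combination (c.im : ℂ) * I_sq
    | linear_combination (-(c.im : ℂ)) * I_sq

theorem conj_smul_sub_I_smul (c : ℂ) (v w : H) :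
    (c.re • v - c.im • w) - I • (c.im • v + c.re • w) = starRingEnd ℂ c • (v - I • w) := by
  have h : starRingEnd ℂ c = (c.re : ℂ) - (c.im : ℂ) * I := by apply Complex.ext <;> simp
  rw [h]
  simp only [← Complex.coe_smul]
  match_scalars <;>
    first
    | ring1
    | linear_combination (c.im : ℂ) * I_sq
    | linear_combination (-(c.im : ℂ)) * I_sq

/-- The complex subspace `V + i V` (algebraic sum). -/
def tomitaDomain (V : StandardSubspace H) : Submodule ℂ H where
  carrier := {x | ∃ v ∈ V.toClosedSubmodule, ∃ w ∈ V.toClosedSubmodule, v + I • w = x}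
  zero_mem' := ⟨0, zero_mem _, 0, zero_mem _, by simp⟩
  add_mem' := by
    rintro _ _ ⟨v, hv, w, hw, rfl⟩ ⟨v', hv', w', hw', rfl⟩
    exact ⟨v + v', add_mem hv hv', w + w', add_mem hw hw', by rw [smul_add]; abel⟩
  smul_mem' := by
    rintro c _ ⟨v, hv, w, hw, rfl⟩
    refine ⟨c.re • v - c.im • w, ?_, c.im • v + c.re • w, ?_, ?_⟩
    · exact V.toClosedSubmodule.toSubmodule.sub_mem
        (V.toClosedSubmodule.toSubmodule.smul_mem _ hv)
        (V.toClosedSubmodule.toSubmodule.smul_mem _ hw)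
    · exact V.toClosedSubmodule.toSubmodule.add_mem
        (V.toClosedSubmodule.toSubmodule.smul_mem _ hv)
        (V.toClosedSubmodule.toSubmodule.smul_mem _ hw)
    · exact smul_add_I_smul c v w

theorem eq_zero_of_mem_of_I_smul_mem (V : StandardSubspace H) {x : H}
    (h : x ∈ V.toClosedSubmodule) (h' : I • x ∈ V.toClosedSubmodule) : x = 0 := by
  have : I • x ∈ V.toClosedSubmodule ⊓ V.toClosedSubmodule.mulI := by
    refine ⟨h', ?_⟩
    exact (ClosedSubmodule.mem_mapEquiv_iff' (scalarSMulCLE H UnitI) _ x).2 h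
  rw [V.IsSeparating] at this
  have h0 : I • x = 0 := this
  simpa using h0

theorem tomita_unique (V : StandardSubspace H) {v w v' w' : H}
    (hv : v ∈ V.toClosedSubmodule) (hw : w ∈ V.toClosedSubmodule)
    (hv' : v' ∈ V.toClosedSubmodule) (hw' : w' ∈ V.toClosedSubmodule)
    (h : v + I • w = v' + I • w') : v = v' ∧ w = w' := by
  have e : I • (w - w') = v' - v := by
    rw [smul_sub, sub_eq_sub_iff_add_eq_add, add_comm, h]
  have h1 : w - w' = 0 := V.eq_zero_of_mem_of_I_smul_mem
    (V.toClosedSubmodule.toSubmodule.sub_mem hw hw')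
    (e ▸ V.toClosedSubmodule.toSubmodule.sub_mem hv' hv)
  rw [h1, smul_zero] at e
  exact ⟨(sub_eq_zero.1 e.symm).symm, sub_eq_zero.1 h1⟩

theorem exists_tomita (V : StandardSubspace H) (x : V.tomitaDomain) :
    ∃ y : H, ∀ v ∈ V.toClosedSubmodule, ∀ w ∈ V.toClosedSubmodule,
      v + I • w = x → y = v - I • w := by
  obtain ⟨v, hv, w, hw, h⟩ := x.2
  refine ⟨v - I • w, fun v' hv' w' hw' h' => ?_⟩
  obtain ⟨rfl, rfl⟩ := V.tomita_unique hv hw hv' hw' (h.trans h'.symm)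
  rfl

/-- The Tomita operator of `V`, the antilinear operator with domain `V + i V` given by
`S (v + i w) = v - i w` for `v, w ∈ V`. -/
noncomputable def tomita (V : StandardSubspace H) : H →ₛₗ.[starRingEnd ℂ] H where
  domain := V.tomitaDomain
  toFun :=
    { toFun := fun x => (V.exists_tomita x).choose
      map_add' := by
        rintro ⟨_, v, hv, w, hw, rfl⟩ ⟨_, v', hv', w', hw', rfl⟩
        rw [(V.exists_tomita ⟨v + I • w, v, hv, w, hw, rfl⟩).choose_spec v hv w hw rfl,
          (V.exists_tomita ⟨v' + I • w', v', hv', w', hw', rfl⟩).choose_spec v' hv' w' hw' rfl,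
          (V.exists_tomita _).choose_spec (v + v') (add_mem hv hv') (w + w') (add_mem hw hw')
            (by simp only [Submodule.coe_add]; rw [smul_add]; abel)]
        rw [smul_add]; abel
      map_smul' := by
        rintro c ⟨_, v, hv, w, hw, rfl⟩
        have e1 : c.re • v - c.im • w ∈ V.toClosedSubmodule :=
          V.toClosedSubmodule.toSubmodule.sub_mem
            (V.toClosedSubmodule.toSubmodule.smul_mem _ hv)
            (V.toClosedSubmodule.toSubmodule.smul_mem _ hw)
        have e2 : c.im • v + c.re • w ∈ V.toClosedSubmodule :=
          V.toClosedSubmodule.toSubmodule.add_mem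
            (V.toClosedSubmodule.toSubmodule.smul_mem _ hv)
            (V.toClosedSubmodule.toSubmodule.smul_mem _ hw)
        rw [(V.exists_tomita ⟨v + I • w, v, hv, w, hw, rfl⟩).choose_spec v hv w hw rfl,
          (V.exists_tomita _).choose_spec _ e1 _ e2 (smul_add_I_smul c v w)]
        exact conj_smul_sub_I_smul c v w }

theorem tomita_apply (V : StandardSubspace H) {v w : H} (hv : v ∈ V.toClosedSubmodule)
    (hw : w ∈ V.toClosedSubmodule) (h : v + I • w ∈ V.tomita.domain) :
    V.tomita ⟨v + I • w, h⟩ = v - I • w :=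
  (V.exists_tomita ⟨v + I • w, h⟩).choose_spec v hv w hw rfl

theorem dense_tomitaDomain (V : StandardSubspace H) : Dense (V.tomitaDomain : Set H) := by
  intro x
  have hx : x ∈ V.toClosedSubmodule ⊔ V.toClosedSubmodule.mulI := by
    rw [V.IsCyclic]; trivial
  rw [ClosedSubmodule.mem_sup] at hx
  refine closure_mono ?_ hx
  intro y hy
  obtain ⟨v, hv, z, hz, rfl⟩ := Submodule.mem_sup.1 hy
  obtain ⟨w, hw, rfl⟩ := hz
  exact ⟨v, hv, w, hw, rfl⟩

/-- The adjoint `S*` of the antilinear operator `S`: a vector `y` is in its domain if there is a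
vector `z = S* y` with `⟪S x, y⟫ = ⟪z, x⟫` for all `x` in the domain of `S`. -/
noncomputable def tomitaAdjoint (V : StandardSubspace H) : H →ₛₗ.[starRingEnd ℂ] H where
  domain :=
    { carrier := {y | ∃ z : H, ∀ x : V.tomita.domain, inner ℂ (V.tomita x) y = inner ℂ z (x : H)}
      zero_mem' := ⟨0, by simp⟩
      add_mem' := by
        rintro y y' ⟨z, hz⟩ ⟨z', hz'⟩
        exact ⟨z + z', fun x => by rw [inner_add_right, inner_add_left, hz, hz']⟩
      smul_mem' := by
        rintro c y ⟨z, hz⟩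
        exact ⟨starRingEnd ℂ c • z, fun x => by
          rw [inner_smul_right, inner_smul_left, hz, Complex.conj_conj]⟩ }
  toFun :=
    { toFun := fun y => y.2.choose
      map_add' := fun y y' => V.dense_tomitaDomain.eq_of_inner_left ℂ fun x hx => by
        have e := (y + y').2.choose_spec ⟨x, hx⟩
        have e1 := y.2.choose_spec ⟨x, hx⟩
        have e2 := y'.2.choose_spec ⟨x, hx⟩
        rw [inner_add_left, ← e1, ← e2, ← inner_add_right]
        exact e.symm
      map_smul' := fun c y => V.dense_tomitaDomain.eq_of_inner_left ℂ fun x hx => by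
        have e := (c • y).2.choose_spec ⟨x, hx⟩
        have e1 := y.2.choose_spec ⟨x, hx⟩
        rw [inner_smul_left, ← e1, Complex.conj_conj, ← inner_smul_right]
        exact e.symm }

theorem inner_tomitaAdjoint (V : StandardSubspace H) (y : V.tomitaAdjoint.domain)
    (x : V.tomita.domain) :
    inner ℂ (V.tomita x) (y : H) = inner ℂ (V.tomitaAdjoint y) (x : H) :=
  y.2.choose_spec x

/-- The modular operator `Δ = S* S` of `V`, with its natural domain
`{x ∈ D(S) | S x ∈ D(S*)}`. -/
noncomputable def modularOp (V : StandardSubspace H) : H →ₗ.[ℂ] H where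
  domain :=
    { carrier := {x | ∃ h : x ∈ V.tomita.domain, V.tomita ⟨x, h⟩ ∈ V.tomitaAdjoint.domain}
      zero_mem' := ⟨zero_mem _, by
        have : V.tomita ⟨0, zero_mem _⟩ = 0 := V.tomita.map_zero
        rw [this]; exact zero_mem _⟩
      add_mem' := by
        rintro x y ⟨hx, hx'⟩ ⟨hy, hy'⟩
        refine ⟨add_mem hx hy, ?_⟩
        have : V.tomita ⟨x + y, add_mem hx hy⟩ = V.tomita ⟨x, hx⟩ + V.tomita ⟨y, hy⟩ :=
          V.tomita.map_add ⟨x, hx⟩ ⟨y, hy⟩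
        rw [this]; exact add_mem hx' hy'
      smul_mem' := by
        rintro c x ⟨hx, hx'⟩
        refine ⟨Submodule.smul_mem _ c hx, ?_⟩
        have : V.tomita ⟨c • x, Submodule.smul_mem _ c hx⟩ =
            starRingEnd ℂ c • V.tomita ⟨x, hx⟩ := V.tomita.map_smulₛₗ c ⟨x, hx⟩
        rw [this]; exact Submodule.smul_mem _ _ hx' }
  toFun :=
    { toFun := fun x => V.tomitaAdjoint ⟨V.tomita ⟨x, x.2.choose⟩, x.2.choose_spec⟩
      map_add' := fun x y => by
        rw [← LinearPMap.map_add]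
        congr 1
        apply Subtype.ext
        exact V.tomita.map_add ⟨x, x.2.choose⟩ ⟨y, y.2.choose⟩
      map_smul' := fun c x => by
        have e : (⟨V.tomita ⟨(c • x : _), (c • x).2.choose⟩, (c • x).2.choose_spec⟩ :
            V.tomitaAdjoint.domain) =
            starRingEnd ℂ c • ⟨V.tomita ⟨x, x.2.choose⟩, x.2.choose_spec⟩ :=
          Subtype.ext (V.tomita.map_smulₛₗ c ⟨x, x.2.choose⟩)
        rw [e, LinearPMap.map_smulₛₗ, Complex.conj_conj, RingHom.id_apply] }

theorem modularOp_mem (V : StandardSubspace H) {x z : H} (hx : x ∈ V.tomita.domain)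
    (h : ∀ u : V.tomita.domain, inner ℂ (V.tomita u) (V.tomita ⟨x, hx⟩) = inner ℂ z (u : H)) :
    ∃ hx' : x ∈ V.modularOp.domain, V.modularOp ⟨x, hx'⟩ = z := by
  have hx' : x ∈ V.modularOp.domain := ⟨hx, z, h⟩
  refine ⟨hx', V.dense_tomitaDomain.eq_of_inner_left ℂ fun u hu => ?_⟩
  rw [← h ⟨u, hu⟩]
  exact (V.inner_tomitaAdjoint ⟨V.tomita ⟨x, hx⟩, z, h⟩ ⟨u, hu⟩).symm

theorem inner_modularOp (V : StandardSubspace H) (x : V.modularOp.domain)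
    (u : V.tomita.domain) :
    inner ℂ (V.modularOp x) (u : H) = inner ℂ (V.tomita u) (V.tomita ⟨x, x.2.choose⟩) :=
  (V.inner_tomitaAdjoint ⟨V.tomita ⟨x, x.2.choose⟩, x.2.choose_spec⟩ u).symm

theorem inner_self_modularOp (V : StandardSubspace H) (x : V.modularOp.domain) :
    inner ℂ (V.modularOp x) (x : H) = ((‖V.tomita ⟨x, x.2.choose⟩‖ ^ 2 : ℝ) : ℂ) := by
  rw [V.inner_modularOp x ⟨x, x.2.choose⟩, inner_self_eq_norm_sq_to_K]
  simp

theorem tomita_tomita (V : StandardSubspace H) (x : V.tomita.domain) :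
    ∃ h : V.tomita x ∈ V.tomita.domain, V.tomita ⟨V.tomita x, h⟩ = x := by
  obtain ⟨_, v, hv, w, hw, rfl⟩ := x
  have hw' : -w ∈ V.toClosedSubmodule := V.toClosedSubmodule.toSubmodule.neg_mem hw
  have e : V.tomita ⟨v + I • w, v, hv, w, hw, rfl⟩ = v + I • (-w) := by
    rw [smul_neg, ← sub_eq_add_neg]
    exact V.tomita_apply hv hw _
  have h : v + I • (-w) ∈ V.tomita.domain := ⟨v, hv, -w, hw', rfl⟩
  refine ⟨e ▸ h, ?_⟩
  have : ∀ y (hy : y ∈ V.tomita.domain), y = v + I • (-w) → V.tomita ⟨y, hy⟩ = v + I • w := by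
    rintro _ hy rfl
    rw [V.tomita_apply hv hw', smul_neg, sub_neg_eq_add]
  exact this _ _ e

/-- `S` is injective, hence so is `Δ`. -/
theorem modularOp_injective (V : StandardSubspace H) (x : V.modularOp.domain)
    (h : V.modularOp x = 0) : x = 0 := by
  have h1 := V.inner_self_modularOp x
  rw [h, inner_zero_left] at h1
  have h2 : V.tomita ⟨x, x.2.choose⟩ = 0 := by
    have : ‖V.tomita ⟨x, x.2.choose⟩‖ ^ 2 = 0 := by exact_mod_cast h1.symm
    simpa using this
  obtain ⟨h3, h4⟩ := V.tomita_tomita ⟨x, x.2.choose⟩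
  have : ∀ y (hy : y ∈ V.tomita.domain), y = 0 → V.tomita ⟨y, hy⟩ = 0 := by
    rintro _ hy rfl
    exact V.tomita.map_zero
  rw [this _ _ h2] at h4
  exact Subtype.ext h4.symm

theorem norm_le_norm_add_modularOp (V : StandardSubspace H) (u : V.modularOp.domain) :
    ‖(u : H)‖ ≤ ‖(u : H) + V.modularOp u‖ := by
  have h1 : ‖(u : H)‖ ^ 2 ≤ (inner ℂ ((u : H) + V.modularOp u) (u : H)).re := by
    rw [inner_add_left, inner_self_modularOp, inner_self_eq_norm_sq_to_K, Complex.add_re,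
      Complex.ofReal_re]
    have : (((‖(u : H)‖ : ℝ) : ℂ) ^ 2).re = ‖(u : H)‖ ^ 2 := by
      rw [← Complex.ofReal_pow, Complex.ofReal_re]
    have h0 := sq_nonneg ‖V.tomita ⟨u, u.2.choose⟩‖
    exact (le_add_of_nonneg_right h0).trans_eq (by rw [← this]; rfl)
  have h2 := (h1.trans (Complex.re_le_norm _)).trans (norm_inner_le_norm (𝕜 := ℂ) _ _)
  by_contra hlt
  push Not at hlt
  have h3 := norm_nonneg ((u : H) + V.modularOp u)
  nlinarith

end Tomita

section ModularGroup

variable {H : Type*} [NormedAddCommGroup H] [InnerProductSpace ℂ H] [CompleteSpace H]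

/-- `1 + Δ` is onto. -/
theorem exists_modularOp_add (V : StandardSubspace H) (x : H) :
    ∃ u : V.modularOp.domain, (u : H) + V.modularOp u = x := by
  let W : Submodule ℝ H := V.toClosedSubmodule.toSubmodule
  have hW : IsClosed (W : Set H) := V.toClosedSubmodule.isClosed
  let K : Submodule ℝ (WithLp 2 (H × H)) :=
    { carrier := {p | p.fst + p.snd ∈ W ∧ I • (p.fst - p.snd) ∈ W}
      zero_mem' := by simp
      add_mem' := by
        rintro p q ⟨h1, h2⟩ ⟨h3, h4⟩
        refine ⟨?_, ?_⟩
        · convert! add_mem h1 h3 using 1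
          simp only [WithLp.add_fst, WithLp.add_snd]; abel
        · convert! add_mem h2 h4 using 1
          simp only [WithLp.add_fst, WithLp.add_snd, ← smul_add]; congr 1; abel
      smul_mem' := by
        rintro c p ⟨h1, h2⟩
        refine ⟨?_, ?_⟩
        · convert! W.smul_mem c h1 using 1
          simp
        · convert! W.smul_mem c h2 using 1
          simp only [WithLp.smul_fst, WithLp.smul_snd, ← smul_sub]
          exact smul_comm _ _ _ }
  have hK : IsClosed (K : Set (WithLp 2 (H × H))) := by
    have c1 : Continuous fun p : WithLp 2 (H × H) => p.fst + p.snd := by fun_prop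
    have c2 : Continuous fun p : WithLp 2 (H × H) => I • (p.fst - p.snd) := by fun_prop
    exact (hW.preimage c1).inter (hW.preimage c2)
  have hKS : ∀ p ∈ K, ∃ h : p.fst ∈ V.tomita.domain, V.tomita ⟨p.fst, h⟩ = p.snd := by
    rintro p ⟨h1, h2⟩
    have m1 : (2⁻¹ : ℝ) • (p.fst + p.snd) ∈ V.toClosedSubmodule := W.smul_mem _ h1
    have m2 : (-2⁻¹ : ℝ) • (I • (p.fst - p.snd)) ∈ V.toClosedSubmodule := W.smul_mem _ h2
    have e1 : p.fst = (2⁻¹ : ℝ) • (p.fst + p.snd) +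
        I • ((-2⁻¹ : ℝ) • (I • (p.fst - p.snd))) := by
      simp only [← Complex.coe_smul]
      push_cast
      match_scalars <;> (ring_nf; simp; try norm_num)
    have e2 : p.snd = (2⁻¹ : ℝ) • (p.fst + p.snd) -
        I • ((-2⁻¹ : ℝ) • (I • (p.fst - p.snd))) := by
      simp only [← Complex.coe_smul]
      push_cast
      match_scalars <;> (ring_nf; simp; try norm_num)
    have hm : p.fst ∈ V.tomita.domain := ⟨_, m1, _, m2, e1.symm⟩
    refine ⟨hm, ?_⟩
    have : ∀ y (hy : y ∈ V.tomita.domain), y = (2⁻¹ : ℝ) • (p.fst + p.snd) +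
        I • ((-2⁻¹ : ℝ) • (I • (p.fst - p.snd))) → V.tomita ⟨y, hy⟩ = p.snd := by
      rintro _ hy rfl
      rw [V.tomita_apply m1 m2, ← e2]
    exact this _ _ e1
  have hSK : ∀ u : V.tomita.domain, WithLp.toLp 2 ((u : H), V.tomita u) ∈ K := by
    rintro ⟨_, v, hv, w, hw, rfl⟩
    have e := V.tomita_apply hv hw ⟨v, hv, w, hw, rfl⟩
    refine ⟨?_, ?_⟩
    · have : (v + I • w) + (v - I • w) = (2 : ℝ) • v := by rw [two_smul]; abel
      change (v + I • w) + V.tomita _ ∈ W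
      rw [e, this]
      exact W.smul_mem (2 : ℝ) hv
    · have : I • ((v + I • w) - (v - I • w)) = (-2 : ℝ) • w := by
        have h : (v + I • w) - (v - I • w) = (2 : ℝ) • (I • w) := by rw [two_smul]; abel
        rw [h, smul_comm, smul_smul, I_mul_I, neg_smul, neg_smul, one_smul, smul_neg]
      change I • ((v + I • w) - V.tomita _) ∈ W
      rw [e, this]
      exact W.smul_mem (-2 : ℝ) hw
  obtain ⟨p, hp, hq⟩ := K.exists_norm_eq_iInf_of_complete_subspace
    hK.isComplete (WithLp.toLp 2 (x, 0))
  rw [Submodule.norm_eq_iInf_iff_real_inner_eq_zero K hp] at hq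
  obtain ⟨hpd, hps⟩ := hKS p hp
  have key : ∀ u : V.tomita.domain,
      (inner ℂ (V.tomita u) p.snd).re = (inner ℂ (x - p.fst) (u : H)).re := by
    intro u
    have := hq _ (hSK u)
    rw [WithLp.prod_inner_apply] at this
    simp only [ClosedSubmodule.inner_real_eq_re_inner] at this
    simp only [WithLp.ofLp_sub, Prod.fst_sub, Prod.snd_sub, zero_sub, inner_neg_left,
      Complex.neg_re] at this
    have h2 : (inner ℂ (V.tomita u) p.snd).re = (inner ℂ p.snd (V.tomita u)).re :=
      inner_re_symm (𝕜 := ℂ) _ _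
    rw [h2]
    simp only [WithLp.ofLp_fst, WithLp.ofLp_snd] at this
    linarith
  have key2 : ∀ u : V.tomita.domain,
      inner ℂ (V.tomita u) (V.tomita ⟨p.fst, hpd⟩) = inner ℂ (x - p.fst) (u : H) := by
    intro u
    rw [hps]
    refine Complex.ext (key u) ?_
    have h := key (I • u)
    rw [LinearPMap.map_smulₛₗ, inner_smul_left, Submodule.coe_smul, inner_smul_right,
      Complex.conj_conj] at h
    rw [Complex.I_mul_re, Complex.I_mul_re] at h
    exact neg_injective h
  obtain ⟨h1, h2⟩ := V.modularOp_mem hpd key2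
  exact ⟨⟨p.fst, h1⟩, by rw [h2]; abel⟩

theorem existsUnique_resolvent (V : StandardSubspace H) :
    ∃! R : H →L[ℂ] H, ∀ x, ∃ h : R x ∈ V.modularOp.domain, R x + V.modularOp ⟨R x, h⟩ = x := by
  let A : V.modularOp.domain →ₗ[ℂ] H := V.modularOp.domain.subtype + V.modularOp.toFun
  have hA : ∀ u, A u = (u : H) + V.modularOp u := fun u => rfl
  have hinj : Function.Injective A := by
    rw [injective_iff_map_eq_zero]
    intro u hu
    have := V.norm_le_norm_add_modularOp u
    rw [← hA, hu, norm_zero] at this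
    exact Subtype.ext (norm_le_zero_iff.1 this)
  have hsurj : Function.Surjective A := fun x => V.exists_modularOp_add x
  let e := LinearEquiv.ofBijective A ⟨hinj, hsurj⟩
  have he : ∀ x, ((e.symm x : V.modularOp.domain) : H) + V.modularOp (e.symm x) = x :=
    fun x => e.apply_symm_apply x
  refine ⟨(V.modularOp.domain.subtype.comp e.symm.toLinearMap).mkContinuous 1 fun x => ?_,
    fun x => ⟨(e.symm x).2, he x⟩, fun R' hR' => ?_⟩
  · rw [one_mul]
    exact (V.norm_le_norm_add_modularOp (e.symm x)).trans_eq (by rw [he])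
  · ext x
    obtain ⟨h, h'⟩ := hR' x
    have : (⟨R' x, h⟩ : V.modularOp.domain) = e.symm x := hinj (h'.trans (he x).symm)
    exact congrArg Subtype.val this

/-- The bounded operator `R = (1 + Δ)⁻¹`: the unique bounded operator on `H` with values in the
domain of `Δ` and `(1 + Δ) R x = x` for all `x`. -/
noncomputable def resolvent (V : StandardSubspace H) : H →L[ℂ] H :=
  V.existsUnique_resolvent.choose

theorem resolvent_mem (V : StandardSubspace H) (x : H) :
    V.resolvent x ∈ V.modularOp.domain :=
  (V.existsUnique_resolvent.choose_spec.1 x).choose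

theorem resolvent_spec (V : StandardSubspace H) (x : H) :
    V.resolvent x + V.modularOp ⟨V.resolvent x, V.resolvent_mem x⟩ = x :=
  (V.existsUnique_resolvent.choose_spec.1 x).choose_spec

theorem modularOp_resolvent (V : StandardSubspace H) (x : H) :
    V.modularOp ⟨V.resolvent x, V.resolvent_mem x⟩ = (1 - V.resolvent) x := by
  rw [sub_apply, eq_sub_iff_add_eq, add_comm]
  exact V.resolvent_spec x

theorem resolvent_nonneg (V : StandardSubspace H) : 0 ≤ V.resolvent := by
  rw [ContinuousLinearMap.nonneg_iff_isPositive, ContinuousLinearMap.isPositive_iff_complex]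
  intro x
  set u : V.modularOp.domain := ⟨V.resolvent x, V.resolvent_mem x⟩
  have hx : (u : H) + V.modularOp u = x := V.resolvent_spec x
  have h1 : inner ℂ (V.resolvent x) x =
      ((‖(u : H)‖ ^ 2 + ‖V.tomita ⟨u, u.2.choose⟩‖ ^ 2 : ℝ) : ℂ) := by
    change inner ℂ (u : H) x = _
    conv_lhs => rw [← hx]
    rw [inner_add_right, ← inner_conj_symm (u : H) (V.modularOp u), V.inner_self_modularOp u,
      inner_self_eq_norm_sq_to_K, Complex.conj_ofReal]
    push_cast
    rfl
  rw [h1]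
  refine ⟨congrArg _ (Complex.ofReal_re _), ?_⟩
  change 0 ≤ ‖(u : H)‖ ^ 2 + ‖V.tomita ⟨u, u.2.choose⟩‖ ^ 2
  positivity

theorem resolvent_le_one (V : StandardSubspace H) : V.resolvent ≤ 1 := by
  rw [← sub_nonneg, ContinuousLinearMap.nonneg_iff_isPositive,
    ContinuousLinearMap.isPositive_iff_complex]
  intro x
  set u : V.modularOp.domain := ⟨V.resolvent x, V.resolvent_mem x⟩
  have hx : (u : H) + V.modularOp u = x := V.resolvent_spec x
  have h1 : inner ℂ ((1 - V.resolvent) x) x =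
      ((‖V.tomita ⟨u, u.2.choose⟩‖ ^ 2 + ‖V.modularOp u‖ ^ 2 : ℝ) : ℂ) := by
    rw [← V.modularOp_resolvent x]
    change inner ℂ (V.modularOp u) x = _
    conv_lhs => rw [← hx]
    rw [inner_add_right, V.inner_self_modularOp u, inner_self_eq_norm_sq_to_K]
    push_cast
    rfl
  rw [h1]
  refine ⟨congrArg _ (Complex.ofReal_re _), ?_⟩
  change 0 ≤ ‖V.tomita ⟨u, u.2.choose⟩‖ ^ 2 + ‖V.modularOp u‖ ^ 2
  positivity

theorem isSelfAdjoint_resolvent (V : StandardSubspace H) : IsSelfAdjoint V.resolvent :=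
  V.resolvent_nonneg.isSelfAdjoint

theorem spectrum_resolvent (V : StandardSubspace H) {z : ℂ} (hz : z ∈ spectrum ℂ V.resolvent) :
    ∃ r ∈ Set.Icc (0 : ℝ) 1, (r : ℂ) = z := by
  have hz' : z = (z.re : ℂ) := V.isSelfAdjoint_resolvent.mem_spectrum_eq_re hz
  have hr : z.re ∈ spectrum ℝ V.resolvent := by
    rw [hz'] at hz
    exact spectrum.of_algebraMap_mem ℂ hz
  refine ⟨z.re, ⟨spectrum_nonneg_of_nonneg V.resolvent_nonneg hr, ?_⟩, hz'.symm⟩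
  have h1 : 1 - z.re ∈ spectrum ℝ (1 - V.resolvent) := by
    have := spectrum.singleton_sub_eq V.resolvent (1 : ℝ)
    rw [map_one] at this
    rw [← this]
    exact Set.sub_mem_sub rfl hr
  have := spectrum_nonneg_of_nonneg (sub_nonneg.2 V.resolvent_le_one) h1
  linarith

theorem injective_resolvent_mul (V : StandardSubspace H) :
    Function.Injective ⇑(V.resolvent * (1 - V.resolvent) : H →L[ℂ] H) := by
  rw [injective_iff_map_eq_zero]
  intro x hx
  have hcomm : V.resolvent * (1 - V.resolvent) = (1 - V.resolvent) * V.resolvent := by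
    rw [mul_sub, sub_mul, mul_one, one_mul]
  have h1 : V.modularOp ⟨V.resolvent (V.resolvent x), V.resolvent_mem _⟩ = 0 := by
    rw [V.modularOp_resolvent]
    rw [hcomm] at hx
    exact hx
  have hz : ∀ y, V.resolvent y = 0 → y = 0 := by
    intro y hy
    have h := V.resolvent_spec y
    have h0 : (⟨V.resolvent y, V.resolvent_mem y⟩ : V.modularOp.domain) = 0 := Subtype.ext hy
    rw [h0, LinearPMap.map_zero, hy, add_zero] at h
    exact h.symm
  exact hz _ (hz _ (congrArg Subtype.val (V.modularOp_injective _ h1)))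

/-- `R (1 - R)` has dense range. -/
theorem denseRange_resolvent_mul (V : StandardSubspace H) :
    DenseRange ⇑(V.resolvent * (1 - V.resolvent) : H →L[ℂ] H) := by
  have hsa : IsSelfAdjoint (V.resolvent * (1 - V.resolvent)) := by
    rw [mul_sub, mul_one]
    exact IsSelfAdjoint.sub V.isSelfAdjoint_resolvent
      (by rw [IsSelfAdjoint, star_mul, V.isSelfAdjoint_resolvent.star_eq])
  set T : H →L[ℂ] H := V.resolvent * (1 - V.resolvent) with hT
  have h : (LinearMap.range T.toLinearMap)ᗮ = ⊥ := by
    rw [eq_bot_iff]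
    intro y hy
    have h2 : T y = 0 := by
      have h3 := (Submodule.mem_orthogonal _ _).1 hy (T (T y)) ⟨T y, rfl⟩
      have h4 : inner ℂ (T (T y)) y = inner ℂ (T y) (T y) := by
        conv_lhs => rw [← hsa.adjoint_eq, ContinuousLinearMap.adjoint_inner_left]
        rw [hsa.adjoint_eq]
      rw [h4] at h3
      exact inner_self_eq_zero.1 h3
    exact V.injective_resolvent_mul (h2.trans (map_zero T).symm)
  have h5 := Submodule.dense_iff_topologicalClosure_eq_top.2
    ((Submodule.topologicalClosure_eq_top_iff).2 h)
  exact h5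

/-- With `l = (1 - r) / r`, i.e. `r = (1 + l)⁻¹`, this is the function `r (1 - r) l ^ (i t)`,
which is continuous for `0 ≤ r ≤ 1` (with value `0` at both ends). -/
noncomputable def powSymbol (t : ℝ) (r : ℂ) : ℂ :=
  r * (1 - r) * ((1 - r) / r) ^ (I * (t : ℂ))

theorem norm_powSymbol (t : ℝ) {r : ℝ} (hr : r ∈ Set.Icc (0 : ℝ) 1) :
    ‖powSymbol t r‖ = r * (1 - r) := by
  obtain ⟨h0, h1⟩ := hr
  rcases h0.eq_or_lt with rfl | h0
  · simp [powSymbol]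
  rcases h1.eq_or_lt with rfl | h1
  · simp [powSymbol]
  have e : ((1 - (r : ℂ)) / r) = (((1 - r) / r : ℝ) : ℂ) := by push_cast; rfl
  have hp : 0 < (1 - r) / r := div_pos (by linarith) h0
  have e2 : (r : ℂ) * (1 - (r : ℂ)) = ((r * (1 - r) : ℝ) : ℂ) := by push_cast; rfl
  rw [powSymbol, e, norm_mul, Complex.norm_cpow_eq_rpow_re_of_pos hp, e2, Complex.norm_real,
    Real.norm_of_nonneg (mul_nonneg h0.le (by linarith))]
  simp

theorem continuousOn_powSymbol (V : StandardSubspace H) (t : ℝ) :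
    ContinuousOn (powSymbol t) (spectrum ℂ V.resolvent) := by
  have hsub : spectrum ℂ V.resolvent ⊆ (fun r : ℝ => (r : ℂ)) '' Set.Icc (0 : ℝ) 1 :=
    fun z hz => V.spectrum_resolvent hz
  refine ContinuousOn.mono ?_ hsub
  have hend : ∀ z : ℂ, z * (1 - z) = 0 →
      ContinuousWithinAt (powSymbol t) ((fun r : ℝ => (r : ℂ)) '' Set.Icc (0 : ℝ) 1) z := by
    intro z hz
    have h0 : powSymbol t z = 0 := by rw [powSymbol, hz, zero_mul]
    rw [ContinuousWithinAt, h0, tendsto_zero_iff_norm_tendsto_zero]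
    have h1 : Filter.Tendsto (fun w : ℂ => ‖w * (1 - w)‖)
        (nhdsWithin z ((fun r : ℝ => (r : ℂ)) '' Set.Icc (0 : ℝ) 1)) (nhds 0) := by
      have hc : Continuous fun w : ℂ => ‖w * (1 - w)‖ := by fun_prop
      have := (hc.tendsto z).mono_left
        (nhdsWithin_le_nhds (s := (fun r : ℝ => (r : ℂ)) '' Set.Icc (0 : ℝ) 1))
      rwa [hz, norm_zero] at this
    refine h1.congr' ?_
    filter_upwards [self_mem_nhdsWithin] with w hw
    obtain ⟨r, hr, rfl⟩ := hw
    have e2 : (r : ℂ) * (1 - (r : ℂ)) = ((r * (1 - r) : ℝ) : ℂ) := by push_cast; rfl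
    simp only
    rw [norm_powSymbol t hr, e2, Complex.norm_real,
      Real.norm_of_nonneg (mul_nonneg hr.1 (by linarith [hr.2]))]
  rintro _ ⟨r, hr, rfl⟩
  rcases hr.1.eq_or_lt with rfl | h0
  · exact hend _ (by simp)
  rcases hr.2.eq_or_lt with rfl | h1
  · exact hend _ (by simp)
  apply ContinuousAt.continuousWithinAt
  have hr0 : (r : ℂ) ≠ 0 := by exact_mod_cast h0.ne'
  have hs : (1 - (r : ℂ)) / r ∈ slitPlane := by
    have e : ((1 - (r : ℂ)) / r) = (((1 - r) / r : ℝ) : ℂ) := by push_cast; rfl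
    rw [e]
    exact Complex.ofReal_mem_slitPlane.2 (div_pos (by linarith) h0)
  have c1 : ContinuousAt (fun z : ℂ => (1 - z) / z) r :=
    (by fun_prop : ContinuousAt (fun z : ℂ => 1 - z) r).div continuousAt_id hr0
  have c2 : ContinuousAt (fun z : ℂ => ((1 - z) / z) ^ (I * (t : ℂ))) r :=
    c1.cpow continuousAt_const hs
  exact ContinuousAt.mul (by fun_prop) c2

theorem norm_cfc_powSymbol (V : StandardSubspace H) (t : ℝ) (x : H) :
    ‖cfc (powSymbol t) V.resolvent x‖ = ‖(V.resolvent * (1 - V.resolvent) : H →L[ℂ] H) x‖ := by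
  have hn : IsStarNormal V.resolvent := V.isSelfAdjoint_resolvent.isStarNormal
  have hc := V.continuousOn_powSymbol t
  have hT : V.resolvent * (1 - V.resolvent) =
      cfc (fun z : ℂ => z * (1 - z)) V.resolvent := by
    rw [cfc_mul (fun z : ℂ => z) (fun z : ℂ => 1 - z) V.resolvent, cfc_sub _ _ V.resolvent,
      cfc_const_one ℂ V.resolvent, cfc_id' ℂ V.resolvent]
  have hstar : star (cfc (powSymbol t) V.resolvent) * cfc (powSymbol t) V.resolvent =
      star (V.resolvent * (1 - V.resolvent)) * (V.resolvent * (1 - V.resolvent)) := by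
    rw [hT, ← cfc_star, ← cfc_star, ← cfc_mul _ _ V.resolvent (hc.star) hc, ← cfc_mul _ _ V.resolvent]
    refine cfc_congr fun z hz => ?_
    obtain ⟨r, hr, rfl⟩ := V.spectrum_resolvent hz
    have e2 : (r : ℂ) * (1 - (r : ℂ)) = ((r * (1 - r) : ℝ) : ℂ) := by push_cast; rfl
    have h1 : ∀ w : ℂ, star w * w = ((‖w‖ ^ 2 : ℝ) : ℂ) := fun w => by
      rw [Complex.star_def, Complex.conj_mul']; push_cast; rfl
    simp only [h1, norm_powSymbol t hr]
    rw [e2, Complex.norm_real, Real.norm_of_nonneg (mul_nonneg hr.1 (by linarith [hr.2]))]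
  have key : ∀ A : H →L[ℂ] H, ((‖A x‖ ^ 2 : ℝ) : ℂ) = inner ℂ ((star A * A) x) x := fun A => by
    change _ = inner ℂ (star A (A x)) x
    rw [ContinuousLinearMap.star_eq_adjoint, ContinuousLinearMap.adjoint_inner_left,
      inner_self_eq_norm_sq_to_K]
    push_cast; rfl
  have h2 := (key (cfc (powSymbol t) V.resolvent)).trans
    ((by rw [hstar] : _ = _).trans (key (V.resolvent * (1 - V.resolvent))).symm)
  have h3 := Complex.ofReal_injective h2
  exact (pow_left_inj₀ (norm_nonneg _) (norm_nonneg _) two_ne_zero).1 h3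

theorem existsUnique_modularPow (V : StandardSubspace H) (t : ℝ) :
    ∃! U : H →L[ℂ] H,
      U * (V.resolvent * (1 - V.resolvent)) = cfc (powSymbol t) V.resolvent := by
  have hd := V.denseRange_resolvent_mul
  have hb : ∃ C : ℝ, ∀ x, ‖(cfc (powSymbol t) V.resolvent : H →L[ℂ] H).toLinearMap x‖ ≤
      C * ‖(V.resolvent * (1 - V.resolvent) : H →L[ℂ] H).toLinearMap x‖ :=
    ⟨1, fun x => by rw [one_mul]; exact (V.norm_cfc_powSymbol t x).le⟩
  refine ⟨(cfc (powSymbol t) V.resolvent : H →L[ℂ] H).toLinearMap.extendOfNorm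
    (V.resolvent * (1 - V.resolvent) : H →L[ℂ] H).toLinearMap, ?_, ?_⟩
  · ext x
    exact LinearMap.extendOfNorm_eq hd hb x
  · intro U hU
    ext x
    refine congrFun (hd.equalizer U.continuous (ContinuousLinearMap.continuous _) ?_) x
    funext y
    have h1 := congrArg (fun B : H →L[ℂ] H => B y) hU
    exact h1.trans (LinearMap.extendOfNorm_eq hd hb y).symm

/-- The unitary operator `Δ ^ (i t)`, i.e. the function `l ↦ l ^ (i t)` of the positive
selfadjoint injective operator `Δ`.  In terms of `R = (1 + Δ)⁻¹` one has `Δ = (1 - R) / R`, so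
`Δ ^ (i t) R (1 - R) = g(R)` with `g r = r (1 - r) ((1 - r) / r) ^ (i t)` continuous on the
spectrum of `R`; as `R (1 - R)` has dense range, this determines `Δ ^ (i t)`. -/
noncomputable def modularPow (V : StandardSubspace H) (t : ℝ) : H →L[ℂ] H :=
  (V.existsUnique_modularPow t).choose

theorem modularPow_mul (V : StandardSubspace H) (t : ℝ) :
    V.modularPow t * (V.resolvent * (1 - V.resolvent)) = cfc (powSymbol t) V.resolvent :=
  (V.existsUnique_modularPow t).choose_spec.1

end ModularGroup

section DirectSum

variable {H : Type*} [NormedAddCommGroup H] [InnerProductSpace ℂ H]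

/-- `V = V₁ ⊕ V₂` is a direct sum of standard subspaces: there is an orthogonal decomposition
`H = H₁ ⊕ H₂` into closed complex subspaces such that `V₁ ⊆ H₁` and `V₂ ⊆ H₂` are standard
subspaces of the Hilbert spaces `H₁` and `H₂` and `V = V₁ + V₂`. -/
def IsDirectSum (V : StandardSubspace H) (V₁ V₂ : ClosedSubmodule ℝ H) : Prop :=
  ∃ (H₁ H₂ : ClosedSubmodule ℂ H) (W₁ : StandardSubspace H₁.toSubmodule)
    (W₂ : StandardSubspace H₂.toSubmodule),
    H₂ = H₁ᗮ ∧
    (V₁ : Set H) = Subtype.val '' (W₁.toClosedSubmodule : Set H₁.toSubmodule) ∧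
    (V₂ : Set H) = Subtype.val '' (W₂.toClosedSubmodule : Set H₂.toSubmodule) ∧
    V.toClosedSubmodule.toSubmodule = V₁.toSubmodule ⊔ V₂.toSubmodule

end DirectSum

end StandardSubspace

/-! Everything is expressed through real orthogonal projections. If `P_W` is the projection onto a
closed real subspace `W`, the one onto `iW` is `x ↦ -i P_W(i x)`; their sum `S_W` (`projAdd`) is
complex linear, their difference `D_W` (`projSub`) is antilinear, and `2 P_W = S_W + D_W`. The
bridge to modular theory is `two_smul_resolvent`: `2R = S_V` for `R = (1 + Δ)⁻¹`.

If `iV₁ ⊥ V₂`, then `P_V = P₁ + P₂` with mutually annihilating parts, so `S₁` commutes with `R` and,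
by `P₁² = P₁`, `D₁ R = (1 - R) D₁`. Exchanging `R` and `1 - R` inverts `Δ`, and antilinearity
conjugates `l ^ (it)`; the two effects cancel, so `D₁` commutes with `Δ ^ (it)`
(`modularPow_comm_of_intertwine`). Hence so does `P₁`, and `V₁` is invariant.

Conversely, if `V₁` is invariant, then `P₁`, and so `S₁`, commutes with every `Δ ^ (it)`. As `R` is
a limit of trigonometric polynomials in `log Δ`, weighted by `R (1 - R)`, `S₁` commutes with `R`
(`commute_resolvent_of_commute_modularPow`). Evaluating `S₁ S_V = S_V S₁` on `y ∈ V₂` forces `i P₁(i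
y) ∈ V`, so `P₁(i y) = 0` because `V ∩ iV = 0`; this is the orthogonality of `iV₁` and `V₂`.

For the decomposition take `H₁` to be the closed complex span of `V₁`. If `V₁` is itself standard,
`V₂` is orthogonal to the dense space `V₁ + iV₁` and vanishes. -/

namespace StandardSubspace

/-! ### Real orthogonal projections and the resolvent formula -/

section RealProjection

variable {H : Type*} [NormedAddCommGroup H] [InnerProductSpace ℂ H]

theorem I_smul_I_smul (x : H) : I • I • x = -x := by
  rw [smul_smul, I_mul_I, neg_one_smul]

variable [CompleteSpace H]

/-- The orthogonal projection onto a closed real subspace `W`, for the real inner product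
`Re ⟪x, y⟫`. -/
noncomputable def realProj (W : ClosedSubmodule ℝ H) : H →L[ℝ] H :=
  W.toSubmodule.starProjection

theorem realProj_mem (W : ClosedSubmodule ℝ H) (x : H) : realProj W x ∈ W :=
  W.toSubmodule.starProjection_apply_mem x

theorem re_inner_realProj (W : ClosedSubmodule ℝ H) {w : H} (hw : w ∈ W) (x : H) :
    (inner ℂ w (realProj W x)).re = (inner ℂ w x).re := by
  have h := W.toSubmodule.starProjection_inner_eq_zero x w hw
  rw [ClosedSubmodule.inner_real_eq_re_inner, inner_sub_left, Complex.sub_re, sub_eq_zero] at h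
  have e1 := inner_re_symm (𝕜 := ℂ) w x
  have e2 := inner_re_symm (𝕜 := ℂ) w (realProj W x)
  exact e2.trans (h.symm.trans e1.symm)

theorem realProj_eq (W : ClosedSubmodule ℝ H) {u x : H} (hu : u ∈ W)
    (h : ∀ w ∈ W, (inner ℂ w u).re = (inner ℂ w x).re) : realProj W x = u := by
  refine (W.toSubmodule.eq_starProjection_of_mem_of_inner_eq_zero hu fun w hw => ?_)
  have e1 := inner_re_symm (𝕜 := ℂ) w x
  have e2 := inner_re_symm (𝕜 := ℂ) w u
  rw [ClosedSubmodule.inner_real_eq_re_inner, inner_sub_left, Complex.sub_re, sub_eq_zero]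
  exact e1.symm.trans ((h w hw).symm.trans e2)

theorem realProj_of_mem (W : ClosedSubmodule ℝ H) {x : H} (hx : x ∈ W) : realProj W x = x :=
  realProj_eq W hx fun _ _ => rfl

theorem realProj_eq_zero (W : ClosedSubmodule ℝ H) {x : H}
    (h : ∀ w ∈ W, (inner ℂ w x).re = 0) : realProj W x = 0 :=
  realProj_eq W (zero_mem _) fun w hw => by rw [h w hw, inner_zero_right, Complex.zero_re]

/-- The sum of the real orthogonal projections onto `W` and `i W`; it is complex linear. -/
noncomputable def projAdd (W : ClosedSubmodule ℝ H) : H →L[ℂ] H where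
  toFun x := realProj W x - I • realProj W (I • x)
  map_add' x y := by simp only [map_add, smul_add]; abel
  map_smul' c x := by
    have h : c • x = c.re • x + c.im • I • x := by
      conv_lhs => rw [← Complex.re_add_im c]
      rw [add_smul, mul_smul, Complex.coe_smul, Complex.coe_smul]
    have h' : I • c • x = c.re • I • x - c.im • x := by
      rw [h, smul_add, smul_comm I c.re, smul_comm I c.im, I_smul_I_smul, smul_neg, sub_eq_add_neg]
    rw [h', h]
    simp only [map_add, map_sub, map_smul, RingHom.id_apply]
    conv_rhs => rw [← Complex.re_add_im c]
    simp only [← Complex.coe_smul]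
    match_scalars <;> first | ring1 | linear_combination (c.im : ℂ) * I_sq
  cont := by fun_prop

theorem projAdd_apply (W : ClosedSubmodule ℝ H) (x : H) :
    projAdd W x = realProj W x - I • realProj W (I • x) := rfl

/-- The difference of the real orthogonal projections onto `W` and `i W`; it is antilinear. -/
noncomputable def projSub (W : ClosedSubmodule ℝ H) : H →L[ℝ] H where
  toFun x := realProj W x + I • realProj W (I • x)
  map_add' x y := by simp only [map_add, smul_add]; abel
  map_smul' c x := by
    simp only [RingHom.id_apply, smul_comm I c, map_smul, smul_add]
  cont := by fun_prop

theorem projSub_apply (W : ClosedSubmodule ℝ H) (x : H) :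
    projSub W x = realProj W x + I • realProj W (I • x) := rfl

theorem projSub_I_smul (W : ClosedSubmodule ℝ H) (x : H) :
    projSub W (I • x) = -(I • projSub W x) := by
  rw [projSub_apply, projSub_apply, I_smul_I_smul, map_neg, smul_add, I_smul_I_smul, smul_neg]
  abel

theorem two_smul_realProj (W : ClosedSubmodule ℝ H) (x : H) :
    (2 : ℝ) • realProj W x = projAdd W x + projSub W x := by
  rw [projAdd_apply, projSub_apply, two_smul]; abel

/-- Idempotence of the projections `P` onto `W` and `P'` onto `iW` gives `(P - P')(P + P') + (P +
P')(P - P') = 2 (P - P')`. For `W = V` this says that `D_V` intertwines `R` and `1 - R`. -/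
theorem projSub_projAdd (W : ClosedSubmodule ℝ H) (x : H) :
    projSub W (projAdd W x) = (2 : ℝ) • projSub W x - projAdd W (projSub W x) := by
  simp only [projSub_apply, projAdd_apply, smul_add, map_add, map_sub, I_smul_I_smul,
    realProj_of_mem W (realProj_mem W _), map_neg, two_smul, smul_neg]
  abel

variable (V : StandardSubspace H)

/-- The candidate `u = (P x - i P(i x)) / 2` is already split along `V + iV`, so `S u` is known, and
`⟪S w, S u⟫ = ⟪x - u, w⟫` follows from the defining property of `P`. Hence `Δ u = x - u`. -/
theorem two_smul_resolvent (x : H) :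
    (2 : ℝ) • V.resolvent x = projAdd V.toClosedSubmodule x := by
  set W := V.toClosedSubmodule
  set p := realProj W x
  set q := realProj W (I • x)
  have hp : p ∈ W := realProj_mem W x
  have hq : q ∈ W := realProj_mem W _
  have m1 : (2⁻¹ : ℝ) • p ∈ W := W.toSubmodule.smul_mem _ hp
  have m2 : (-2⁻¹ : ℝ) • q ∈ W := W.toSubmodule.smul_mem _ hq
  set u : H := (2⁻¹ : ℝ) • p + I • ((-2⁻¹ : ℝ) • q) with hu
  have hud : u ∈ V.tomita.domain := ⟨_, m1, _, m2, rfl⟩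
  have hSu : V.tomita ⟨u, hud⟩ = (2⁻¹ : ℝ) • p - I • ((-2⁻¹ : ℝ) • q) := V.tomita_apply m1 m2 hud
  have hre : ∀ w : V.tomita.domain,
      (inner ℂ (V.tomita w) (V.tomita ⟨u, hud⟩)).re = (inner ℂ (x - u) (w : H)).re := by
    rintro ⟨y, hy⟩
    obtain ⟨v, hv, v', hv', rfl⟩ := id hy
    rw [hSu, V.tomita_apply hv hv' hy]
    have s1 : ∀ a b : H, (inner ℂ a b).re = (inner ℂ b a).re := fun a b =>
      inner_re_symm (𝕜 := ℂ) a b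
    have a1 := re_inner_realProj W hv x
    have a2 := re_inner_realProj W hv' (I • x)
    have a3 := re_inner_realProj W hv' x
    have a4 := re_inner_realProj W hv (I • x)
    rw [s1 (x - u)]
    simp only [hu, ← Complex.coe_smul, inner_sub_left, inner_sub_right, inner_add_left,
      inner_add_right, inner_smul_left, inner_smul_right] at a1 a2 a3 a4 ⊢
    simp at a1 a2 a3 a4 ⊢
    change (inner ℂ v p).re = _ at a1
    change (inner ℂ v' q).re = _ at a2
    linarith
  have him : ∀ w : V.tomita.domain,
      inner ℂ (V.tomita w) (V.tomita ⟨u, hud⟩) = inner ℂ (x - u) (w : H) := by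
    -- Both sides are complex linear in `w`, so real parts at `i w` give the imaginary parts at `w`.
    intro w
    refine Complex.ext (hre w) ?_
    have h := hre (I • w)
    rw [LinearPMap.map_smulₛₗ, inner_smul_left, Submodule.coe_smul, inner_smul_right,
      Complex.conj_conj] at h
    rw [Complex.I_mul_re, Complex.I_mul_re] at h
    exact neg_injective h
  obtain ⟨h1, h2⟩ := V.modularOp_mem hud him
  -- Uniqueness: `1 + Δ` is bounded below, and it sends both `R x` and `u` to `x`.
  have h3 := V.norm_le_norm_add_modularOp (⟨V.resolvent x, V.resolvent_mem x⟩ - ⟨u, h1⟩)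
  have h4 := V.resolvent_spec x
  rw [LinearPMap.map_sub, h2] at h3
  have h5 : V.resolvent x = u := by
    rw [← sub_eq_zero, ← norm_le_zero_iff]
    refine h3.trans_eq ?_
    rw [norm_eq_zero]
    calc _ = (V.resolvent x + V.modularOp ⟨V.resolvent x, V.resolvent_mem x⟩) - x := by
          simp only [AddSubgroupClass.coe_sub]; abel
      _ = 0 := by rw [h4, sub_self]
  rw [h5, hu, projAdd_apply, smul_add, smul_smul, smul_comm I (-2⁻¹ : ℝ), smul_smul]
  norm_num
  rw [← sub_eq_add_neg]

end RealProjection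

/-! ### Functions of `log Δ` as symbols on the spectrum of `R` -/

section LogSymbol

/-- The function `r (1 - r) f (log l)` with `l = (1 - r) / r`, where `r` is the real part of the
argument. -/
noncomputable def logSymbol (f : ℝ → ℂ) (z : ℂ) : ℂ :=
  z * (1 - z) * f (Real.log ((1 - z.re) / z.re))

theorem continuousOn_logSymbol {f : ℝ → ℂ} (hf : Continuous f) {C : ℝ} (hC : ∀ s, ‖f s‖ ≤ C) :
    ContinuousOn (logSymbol f) ((fun r : ℝ => (r : ℂ)) '' Set.Icc (0 : ℝ) 1) := by
  -- At `r = 0` and `r = 1` the logarithm takes a default value; this is harmless, since `f` is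
  -- bounded and the weight tends to zero.
  have hend : ∀ z : ℂ, z * (1 - z) = 0 →
      ContinuousWithinAt (logSymbol f) ((fun r : ℝ => (r : ℂ)) '' Set.Icc (0 : ℝ) 1) z := by
    intro z hz
    have h0 : logSymbol f z = 0 := by rw [logSymbol, hz, zero_mul]
    rw [ContinuousWithinAt, h0, tendsto_zero_iff_norm_tendsto_zero]
    have hc : Continuous fun w : ℂ => ‖w * (1 - w)‖ * C := by fun_prop
    have h1 := (hc.tendsto z).mono_left
      (nhdsWithin_le_nhds (s := (fun r : ℝ => (r : ℂ)) '' Set.Icc (0 : ℝ) 1))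
    rw [hz, norm_zero, zero_mul] at h1
    refine squeeze_zero (fun _ => norm_nonneg _) (fun w => ?_) h1
    rw [logSymbol, norm_mul]
    exact mul_le_mul_of_nonneg_left (hC _) (norm_nonneg _)
  rintro _ ⟨r, hr, rfl⟩
  rcases hr.1.eq_or_lt with rfl | h0
  · exact hend _ (by simp)
  rcases hr.2.eq_or_lt with rfl | h1
  · exact hend _ (by simp)
  apply ContinuousAt.continuousWithinAt
  have h2 : ContinuousAt (fun z : ℂ => Real.log ((1 - z.re) / z.re)) r := by
    refine ContinuousAt.log (ContinuousAt.div (by fun_prop) (by fun_prop) ?_) ?_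
    · exact h0.ne'
    · exact (div_pos (by simpa using h1) (by simpa using h0)).ne'
  exact ContinuousAt.mul (by fun_prop) (hf.continuousAt.comp h2)

theorem powSymbol_eq_logSymbol (t : ℝ) {r : ℝ} (hr : r ∈ Set.Icc (0 : ℝ) 1) :
    powSymbol t r = logSymbol (fun s => Complex.exp (I * t * s)) r := by
  rcases hr.1.eq_or_lt with rfl | h0
  · simp [powSymbol, logSymbol]
  rcases hr.2.eq_or_lt with rfl | h1
  · simp [powSymbol, logSymbol]
  have hp : 0 < (1 - r) / r := div_pos (by linarith) h0
  have e : ((1 - (r : ℂ)) / r) = (((1 - r) / r : ℝ) : ℂ) := by push_cast; rfl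
  rw [powSymbol, logSymbol, e, Complex.cpow_def_of_ne_zero (by exact_mod_cast hp.ne'),
    ← Complex.ofReal_log hp.le, Complex.ofReal_re, mul_comm (I * (t : ℂ))]

/-- This exhibits `R` as the function `s ↦ sigmoid (-s)` of `log Δ`. -/
theorem sigmoid_neg_log {r : ℝ} (h0 : 0 < r) (h1 : r < 1) :
    Real.sigmoid (-Real.log ((1 - r) / r)) = r := by
  rw [Real.sigmoid_def, neg_neg, Real.exp_log (div_pos (by linarith) h0)]
  field_simp
  ring

theorem abs_sigmoid_sub_le (a b : ℝ) : |Real.sigmoid a - Real.sigmoid b| ≤ |a - b| := by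
  have h : LipschitzWith 1 Real.sigmoid := by
    refine lipschitzWith_of_nnnorm_deriv_le differentiable_sigmoid fun x => ?_
    have h0 := Real.sigmoid_pos x
    have h1 := Real.sigmoid_lt_one x
    rw [← NNReal.coe_le_coe, coe_nnnorm, Real.deriv_sigmoid, Real.norm_eq_abs, abs_le]
    constructor <;> simp <;> nlinarith
  simpa [Real.dist_eq] using h.dist_le_mul a b

/-- The weight absorbs a quadratic growth in `log l`. By the symmetry `r ↔ 1 - r` only `u ≥ 1`
matters, where `log √u ≤ √u` gives `(log u)² ≤ 4 u`. -/
theorem mul_one_sub_mul_sq_log_le {r : ℝ} (h0 : 0 < r) (h1 : r < 1) :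
    r * (1 - r) * Real.log ((1 - r) / r) ^ 2 ≤ 4 := by
  have key : ∀ u : ℝ, 1 ≤ u → Real.log u ^ 2 ≤ 4 * u := by
    intro u hu
    have hu0 : 0 ≤ u := by linarith
    have h2 := Real.log_le_self (Real.sqrt_nonneg u)
    rw [Real.log_sqrt hu0] at h2
    have h3 := Real.log_nonneg hu
    have h4 := Real.sq_sqrt hu0
    nlinarith
  have hb : 0 < 1 - r := by linarith
  rcases le_total r (1 - r) with h | h
  · have h2 := key ((1 - r) / r) ((one_le_div h0).2 h)
    calc _ ≤ r * (1 - r) * (4 * ((1 - r) / r)) := by gcongr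
      _ = 4 * (1 - r) ^ 2 := by field_simp
      _ ≤ 4 := by nlinarith
  · have h2 := key (r / (1 - r)) ((one_le_div hb).2 h)
    have h3 : Real.log ((1 - r) / r) ^ 2 = Real.log (r / (1 - r)) ^ 2 := by
      rw [← inv_div, Real.log_inv, neg_sq]
    rw [h3]
    calc _ ≤ r * (1 - r) * (4 * (r / (1 - r))) := by gcongr
      _ = 4 * r ^ 2 := by field_simp
      _ ≤ 4 := by nlinarith

/-- A global quadratic bound is wanted, to match the `(log l)²` that the weight can absorb: near
zero the error is cubic, and beyond `1` it is at most `1 + x`. -/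
theorem abs_sin_sub_self_le (x : ℝ) : |Real.sin x - x| ≤ 2 * x ^ 2 := by
  have key : ∀ x : ℝ, 0 ≤ x → |Real.sin x - x| ≤ 2 * x ^ 2 := by
    intro x hx
    have h1 := Real.sin_le hx
    have h2 := Real.sin_ge_sub_cube hx
    have h3 := Real.neg_one_le_sin x
    rw [abs_le]
    refine ⟨?_, by nlinarith⟩
    rcases le_total x 1 with h | h
    · nlinarith [mul_nonneg (sq_nonneg x) (sub_nonneg.2 h)]
    · nlinarith
  rcases le_total 0 x with h | h
  · exact key x h
  · have := key (-x) (by linarith)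
    rwa [Real.sin_neg, neg_sq, sub_neg_eq_add, neg_add_eq_sub, abs_sub_comm] at this

end LogSymbol

/-! ### Commutants of the modular group and of the resolvent -/

section ModularGroup

variable {H : Type*} [NormedAddCommGroup H] [InnerProductSpace ℂ H] [CompleteSpace H]
variable (V : StandardSubspace H)

theorem spectrum_resolvent_subset :
    spectrum ℂ V.resolvent ⊆ (fun r : ℝ => (r : ℂ)) '' Set.Icc (0 : ℝ) 1 :=
  fun _ hz => V.spectrum_resolvent hz

theorem modularPow_mul_eq_cfc_logSymbol (t : ℝ) :
    V.modularPow t * (V.resolvent * (1 - V.resolvent)) =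
      cfc (logSymbol fun s => Complex.exp (I * t * s)) V.resolvent := by
  rw [modularPow_mul]
  refine cfc_congr fun z hz => ?_
  obtain ⟨r, hr, rfl⟩ := V.spectrum_resolvent hz
  exact powSymbol_eq_logSymbol t hr

theorem resolvent_mul_eq_cfc :
    V.resolvent * (1 - V.resolvent) = cfc (fun z : ℂ => z * (1 - z)) V.resolvent := by
  have hn : IsStarNormal V.resolvent := V.isSelfAdjoint_resolvent.isStarNormal
  rw [cfc_mul (fun z : ℂ => z) (fun z : ℂ => 1 - z) V.resolvent, cfc_sub _ _ V.resolvent,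
    cfc_const_one ℂ V.resolvent, cfc_id' ℂ V.resolvent]

theorem isSelfAdjoint_resolvent_mul : IsSelfAdjoint (V.resolvent * (1 - V.resolvent)) := by
  rw [mul_sub, mul_one]
  exact IsSelfAdjoint.sub V.isSelfAdjoint_resolvent
    (by rw [IsSelfAdjoint, star_mul, V.isSelfAdjoint_resolvent.star_eq])

/-- Since `R (1 - R)` has dense range, it can be cancelled on the right. -/
theorem eq_of_mul_resolvent_mul_eq {A B : H →L[ℂ] H}
    (h : A * (V.resolvent * (1 - V.resolvent)) = B * (V.resolvent * (1 - V.resolvent))) :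
    A = B := by
  ext x
  refine congrFun (V.denseRange_resolvent_mul.equalizer A.continuous B.continuous ?_) x
  funext y
  exact congrArg (fun C : H →L[ℂ] H => C y) h

theorem commute_of_mul_eq_cfc {B : H →L[ℂ] H} {f : ℂ → ℂ}
    (h : B * (V.resolvent * (1 - V.resolvent)) = cfc f V.resolvent) :
    Commute (V.resolvent * (1 - V.resolvent)) B := by
  refine V.eq_of_mul_resolvent_mul_eq ?_
  rw [mul_assoc, h, V.resolvent_mul_eq_cfc]
  exact cfc_commute_cfc _ _ _

/-- An operator commuting with the selfadjoint `R` commutes with all its continuous functions, in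
particular with `Δ ^ (it) R (1 - R)`; then `R (1 - R)` is cancelled. -/
theorem commute_modularPow_of_commute_resolvent {A : H →L[ℂ] H} (hA : Commute A V.resolvent)
    (t : ℝ) : Commute A (V.modularPow t) := by
  refine V.eq_of_mul_resolvent_mul_eq ?_
  have hs : Commute (star V.resolvent) A := by
    rw [V.isSelfAdjoint_resolvent.star_eq]; exact hA.symm
  have h1 : Commute A (cfc (powSymbol t) V.resolvent) := (hA.symm.cfc hs _).symm
  have h2 : Commute A (V.resolvent * (1 - V.resolvent)) :=
    hA.mul_right ((Commute.one_right A).sub_right hA)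
  rw [mul_assoc, modularPow_mul, h1.eq, ← modularPow_mul, mul_assoc, ← h2.eq, mul_assoc]

theorem star_modularPow (t : ℝ) : star (V.modularPow t) = V.modularPow (-t) := by
  set T := V.resolvent * (1 - V.resolvent) with hT
  have hTs : star T = T := V.isSelfAdjoint_resolvent_mul
  have hc := V.commute_of_mul_eq_cfc (V.modularPow_mul t)
  refine V.eq_of_mul_resolvent_mul_eq ?_
  have h1 : star (V.modularPow t) * T = star (T * V.modularPow t) := by
    rw [star_mul, hTs]
  rw [← hT, h1, hc.eq, modularPow_mul_eq_cfc_logSymbol, ← hT.symm,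
    modularPow_mul_eq_cfc_logSymbol, ← cfc_star]
  refine cfc_congr fun z hz => ?_
  obtain ⟨r, hr, rfl⟩ := V.spectrum_resolvent hz
  simp [logSymbol, ← Complex.exp_conj]

theorem continuousOn_logSymbol_addCircle {P : ℝ} (hP : 0 < P) (g : C(AddCircle P, ℂ)) :
    ContinuousOn (logSymbol fun s => g (s : AddCircle P)) (spectrum ℂ V.resolvent) := by
  have : Fact (0 < P) := ⟨hP⟩
  exact (continuousOn_logSymbol (g.continuous.comp (AddCircle.continuous_mk' P))
    fun s => g.norm_coe_le_norm _).mono V.spectrum_resolvent_subset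

/-- Trigonometric polynomials of `log Δ` commute with the commutant of the modular group. -/
theorem exists_mul_eq_cfc_of_mem_span {P : ℝ} (hP : 0 < P) {A : H →L[ℂ] H}
    (hA : ∀ t, Commute A (V.modularPow t)) {g : C(AddCircle P, ℂ)}
    (hg : g ∈ Submodule.span ℂ (Set.range (fourier (T := P)))) :
    ∃ B : H →L[ℂ] H, Commute A B ∧
      B * (V.resolvent * (1 - V.resolvent)) =
        cfc (logSymbol fun s => g (s : AddCircle P)) V.resolvent := by
  induction hg using Submodule.span_induction with
  | mem g hg =>
    obtain ⟨n, rfl⟩ := hg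
    -- The `n`-th character of the circle of length `P` is `s ↦ exp (i t s)` with `t = 2πn / P`.
    refine ⟨V.modularPow (2 * Real.pi * n / P), hA _, ?_⟩
    rw [modularPow_mul_eq_cfc_logSymbol]
    congr 1
    funext z
    simp only [logSymbol, fourier_coe_apply]
    congr 2
    push_cast
    ring
  | zero =>
    refine ⟨0, Commute.zero_right A, ?_⟩
    rw [zero_mul, ← cfc_const_zero ℂ V.resolvent]
    congr 1
    funext z
    simp [logSymbol]
  | add g g' _ _ hg hg' =>
    obtain ⟨B, h1, h2⟩ := hg
    obtain ⟨B', h1', h2'⟩ := hg'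
    refine ⟨B + B', h1.add_right h1', ?_⟩
    rw [add_mul, h2, h2', ← cfc_add V.resolvent _ _ (V.continuousOn_logSymbol_addCircle hP g)
      (V.continuousOn_logSymbol_addCircle hP g')]
    congr 1
    funext z
    simp only [logSymbol, ContinuousMap.add_apply]
    ring
  | smul c g _ hg =>
    obtain ⟨B, h1, h2⟩ := hg
    refine ⟨c • B, h1.smul_right c, ?_⟩
    rw [smul_mul_assoc, h2, ← cfc_smul c _ V.resolvent (V.continuousOn_logSymbol_addCircle hP g)]
    congr 1
    funext z
    simp only [logSymbol, ContinuousMap.smul_apply, smul_eq_mul]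
    ring

/-- The resolvent is a limit of trigonometric polynomials of `log Δ`, after multiplication by
`R (1 - R)`. -/
theorem exists_commute_norm_sub_le {A : H →L[ℂ] H}
    (hA : ∀ t, Commute A (V.modularPow t)) {ε : ℝ} (hε : 0 < ε) :
    ∃ B : H →L[ℂ] H, Commute A B ∧ Commute (V.resolvent * (1 - V.resolvent)) B ∧
      ‖B * (V.resolvent * (1 - V.resolvent)) -
        V.resolvent * (V.resolvent * (1 - V.resolvent))‖ ≤ ε := by
  have hn : IsStarNormal V.resolvent := V.isSelfAdjoint_resolvent.isStarNormal
  -- Half of `ε` pays for periodization, whose weighted error is `8 / N`: a factor `2` from the sine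
  -- bound and `4` from the weighted logarithm bound.
  obtain ⟨N, hN⟩ := exists_nat_gt (8 / (ε / 2))
  have hN0 : (0 : ℝ) < N := lt_trans (by positivity) hN
  have hNε : 8 / (N : ℝ) ≤ ε / 2 := by
    rw [div_lt_iff₀ (by positivity)] at hN
    rw [div_le_iff₀ hN0]
    linarith
  have hP : 0 < 2 * Real.pi * N := by positivity
  have : Fact (0 < 2 * Real.pi * N) := ⟨hP⟩
  -- `sigmoid (-s)` is not periodic; replacing `s` by `N sin (s / N)` makes it so with period `2πN`,
  -- and changes `s` by at most `2 s² / N`.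
  let F : C(AddCircle (2 * Real.pi * N), ℂ) :=
    { toFun := fun x => (Real.sigmoid (-(N * (AddCircle.toCircle x : ℂ).im)) : ℂ)
      continuous_toFun := by
        have h1 : Continuous fun x : AddCircle (2 * Real.pi * N) => (AddCircle.toCircle x : ℂ) :=
          continuous_subtype_val.comp AddCircle.continuous_toCircle
        have h2 := Complex.continuous_im.comp h1
        exact Complex.continuous_ofReal.comp
          (continuous_sigmoid.comp ((continuous_const.mul h2).neg)) }
  have hF : ∀ s : ℝ, F (s : AddCircle (2 * Real.pi * N)) =
      (Real.sigmoid (-(N * Real.sin (s / N))) : ℂ) := by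
    intro s
    change ((Real.sigmoid (-(N * (AddCircle.toCircle (s : AddCircle (2 * Real.pi * N)) : ℂ).im)) :
      ℝ) : ℂ) = _
    have e : 2 * Real.pi / (2 * Real.pi * N) * s = s / N := by field_simp
    rw [AddCircle.toCircle_apply_mk, Circle.coe_exp, Complex.exp_ofReal_mul_I_im, e]
  have hmem : F ∈ (Submodule.span ℂ
      (Set.range (fourier (T := 2 * Real.pi * N)))).topologicalClosure := by
    rw [span_fourier_closure_eq_top]; trivial
  obtain ⟨g, hg, hgF⟩ := Metric.mem_closure_iff.1 hmem (ε / 2) (by positivity)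
  obtain ⟨B, hB1, hB2⟩ := V.exists_mul_eq_cfc_of_mem_span hP hA hg
  refine ⟨B, hB1, V.commute_of_mul_eq_cfc hB2, ?_⟩
  have hR : V.resolvent * (V.resolvent * (1 - V.resolvent)) =
      cfc (fun z : ℂ => z * (z * (1 - z))) V.resolvent := by
    rw [cfc_mul (fun z : ℂ => z) (fun z : ℂ => z * (1 - z)) V.resolvent, cfc_id' ℂ V.resolvent,
      V.resolvent_mul_eq_cfc]
  rw [hB2, hR, ← cfc_sub _ _ V.resolvent (V.continuousOn_logSymbol_addCircle hP g)]
  refine norm_cfc_le hε.le fun z hz => ?_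
  obtain ⟨r, hr, rfl⟩ := V.spectrum_resolvent hz
  rcases hr.1.eq_or_lt with rfl | h0
  · simpa [logSymbol] using hε.le
  rcases hr.2.eq_or_lt with rfl | h1
  · simpa [logSymbol] using hε.le
  set s := Real.log ((1 - r) / r) with hs
  have hsr : Real.sigmoid (-s) = r := sigmoid_neg_log h0 h1
  have hT0 : 0 ≤ r * (1 - r) := mul_nonneg h0.le (by linarith)
  have e1 : logSymbol (fun s => g (s : AddCircle (2 * Real.pi * N))) r - r * (r * (1 - r)) =
      ((r * (1 - r) : ℝ) : ℂ) * ((g (s : AddCircle (2 * Real.pi * N)) - F s) +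
        ((Real.sigmoid (-(N * Real.sin (s / N))) - Real.sigmoid (-s) : ℝ) : ℂ)) := by
    rw [hF, hsr, logSymbol, Complex.ofReal_re, ← hs]
    push_cast
    ring
  have b1 : ‖g (s : AddCircle (2 * Real.pi * N)) - F s‖ ≤ ε / 2 := by
    rw [← dist_eq_norm, dist_comm]
    exact (ContinuousMap.dist_apply_le_dist _).trans hgF.le
  have b2 : |Real.sigmoid (-(N * Real.sin (s / N))) - Real.sigmoid (-s)| ≤ 2 * s ^ 2 / N := by
    refine (abs_sigmoid_sub_le _ _).trans ?_
    have e : -(N * Real.sin (s / N)) - -s = -(N * (Real.sin (s / N) - s / N)) := by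
      field_simp; ring
    rw [e, abs_neg, abs_mul, abs_of_pos hN0]
    refine (mul_le_mul_of_nonneg_left (abs_sin_sub_self_le _) hN0.le).trans_eq ?_
    field_simp
  have b3 := mul_one_sub_mul_sq_log_le h0 h1
  rw [← hs] at b3
  rw [e1, norm_mul, Complex.norm_real, Real.norm_of_nonneg hT0]
  have b4 := norm_add_le (g (s : AddCircle (2 * Real.pi * N)) - F s)
    ((Real.sigmoid (-(N * Real.sin (s / N))) - Real.sigmoid (-s) : ℝ) : ℂ)
  rw [Complex.norm_real, Real.norm_eq_abs] at b4
  calc _ ≤ r * (1 - r) * (ε / 2 + 2 * s ^ 2 / N) :=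
        mul_le_mul_of_nonneg_left (b4.trans (add_le_add b1 b2)) hT0
    _ = r * (1 - r) * (ε / 2) + 2 * (r * (1 - r) * s ^ 2) / N := by ring
    _ ≤ 1 * (ε / 2) + 2 * 4 / N := by gcongr; nlinarith
    _ ≤ ε := by linarith

/-- With `T = R (1 - R)`, the approximants `B` of `R` are close only after multiplication by `T`.
Hence the commutator is sandwiched as `T [A, R] T`, which is rewritten in terms of `B T - R T` and
so is arbitrarily small. Dense range cancels the right `T`, injectivity the left one. -/
theorem commute_resolvent_of_commute_modularPow {A : H →L[ℂ] H}
    (hA : ∀ t, Commute A (V.modularPow t)) : Commute A V.resolvent := by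
  set T := V.resolvent * (1 - V.resolvent) with hT
  have hRT : V.resolvent * T = T * V.resolvent := by rw [hT]; noncomm_ring
  have key : T * (A * V.resolvent) * T = T * (V.resolvent * A) * T := by
    rw [← sub_eq_zero, ← norm_le_zero_iff]
    refine le_of_forall_pos_le_add fun ε hε => ?_
    have hC : 0 < 2 * ‖T‖ * ‖A‖ + 1 := by positivity
    obtain ⟨B, hAB, hTB, hB⟩ := V.exists_commute_norm_sub_le hA (div_pos hε hC)
    rw [← hT] at hTB hB
    have e : T * (A * V.resolvent) * T - T * (V.resolvent * A) * T =
        (B * T - V.resolvent * T) * (A * T) - (T * A) * (B * T - V.resolvent * T) := by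
      have h1 : B * T * (A * T) = T * A * (B * T) := by
        rw [← hTB.eq, mul_assoc, ← mul_assoc B, ← hAB.eq]; simp only [mul_assoc, hTB.eq]
      rw [sub_mul, mul_sub, h1, hRT]
      simp only [mul_assoc, hRT]
      abel
    rw [e, zero_add]
    have n1 := norm_sub_le ((B * T - V.resolvent * T) * (A * T))
      ((T * A) * (B * T - V.resolvent * T))
    have n2 := norm_mul_le (B * T - V.resolvent * T) (A * T)
    have n3 := norm_mul_le (T * A) (B * T - V.resolvent * T)
    have n4 := norm_mul_le A T
    have n5 := norm_mul_le T A
    have n6 : ‖B * T - V.resolvent * T‖ * (2 * ‖T‖ * ‖A‖ + 1) ≤ ε := by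
      rwa [le_div_iff₀ hC] at hB
    have n0 := norm_nonneg (B * T - V.resolvent * T)
    nlinarith [mul_le_mul_of_nonneg_left n4 n0, mul_le_mul_of_nonneg_right n5 n0]
  have h := V.eq_of_mul_resolvent_mul_eq key
  ext x
  refine V.injective_resolvent_mul ?_
  exact congrArg (fun C : H →L[ℂ] H => C x) h

end ModularGroup

/-! ### Antilinear operators exchanging `R` and `1 - R` -/

section Antilinear

variable {H : Type*} [NormedAddCommGroup H] [InnerProductSpace ℂ H]

theorem aeval_intertwine {A B : H →L[ℂ] H} {D : H →L[ℝ] H} (h : ∀ x, D (A x) = B (D x))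
    (p : Polynomial ℝ) (x : H) :
    D (Polynomial.aeval A p x) = Polynomial.aeval B p (D x) := by
  induction p using Polynomial.induction_on' with
  | add p q hp hq => simp only [map_add, add_apply, hp, hq]
  | monomial n a =>
    have hn : ∀ n : ℕ, D ((A ^ n) x) = (B ^ n) (D x) := by
      intro n
      induction n with
      | zero => rfl
      | succ n ih =>
        rw [pow_succ', pow_succ']
        change D (A ((A ^ n) x)) = B ((B ^ n) (D x))
        rw [h, ih]
    rw [Polynomial.aeval_monomial, Polynomial.aeval_monomial, ← Algebra.smul_def,
      ← Algebra.smul_def]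
    change D (a • (A ^ n) x) = a • (B ^ n) (D x)
    rw [map_smul, hn]

variable [CompleteSpace H] (V : StandardSubspace H)

theorem spectrum_real_resolvent_subset : spectrum ℝ V.resolvent ⊆ Set.Icc (0 : ℝ) 1 := by
  intro r hr
  have h : (r : ℂ) ∈ spectrum ℂ V.resolvent := spectrum.algebraMap_mem ℂ hr
  obtain ⟨r', hr', e⟩ := V.spectrum_resolvent h
  rwa [← Complex.ofReal_injective e]

/-- Real polynomials pass through `D` with `R` turned into `1 - R`, and Weierstrass approximation on
`[0, 1]` extends this to continuous `f`. Coefficients must be real because `D` is only real linear.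
-/
theorem cfc_intertwine {D : H →L[ℝ] H}
    (hD : ∀ x, D (V.resolvent x) = (1 - V.resolvent) (D x)) {f : ℝ → ℝ}
    (hf : ContinuousOn f (Set.Icc 0 1)) (x : H) :
    D (cfc f V.resolvent x) = cfc (fun r => f (1 - r)) V.resolvent (D x) := by
  have hsa := V.isSelfAdjoint_resolvent
  have hsub := V.spectrum_real_resolvent_subset
  have hf' : ContinuousOn (fun r : ℝ => f (1 - r)) (Set.Icc 0 1) :=
    hf.comp (by fun_prop) fun r hr => ⟨by linarith [hr.2], by linarith [hr.1]⟩
  rw [← sub_eq_zero, ← norm_le_zero_iff]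
  refine le_of_forall_pos_le_add fun ε hε => ?_
  set C := ‖D‖ * ‖x‖ + ‖D x‖ + 1 with hCdef
  have hC : 0 < C := by positivity
  obtain ⟨p, hp⟩ := exists_polynomial_near_of_continuousOn 0 1 f hf (ε / C) (div_pos hε hC)
  have b1 : ‖cfc f V.resolvent - Polynomial.aeval V.resolvent p‖ ≤ ε / C := by
    rw [← cfc_polynomial p V.resolvent,
      ← cfc_sub f _ V.resolvent (hf.mono hsub) p.continuous.continuousOn]
    refine norm_cfc_le (by positivity) fun r hr => ?_
    rw [norm_sub_rev]
    exact (hp r (hsub hr)).le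
  have b2 : ‖Polynomial.aeval (1 - V.resolvent) p - cfc (fun r => f (1 - r)) V.resolvent‖ ≤
      ε / C := by
    have e : (1 - V.resolvent) = cfc (fun r : ℝ => 1 - r) V.resolvent := by
      rw [cfc_sub _ _ V.resolvent, cfc_const_one ℝ V.resolvent, cfc_id' ℝ V.resolvent]
    rw [e, ← cfc_map_polynomial p (fun r : ℝ => 1 - r) V.resolvent,
      ← cfc_sub _ _ V.resolvent (by fun_prop) (hf'.mono hsub)]
    refine norm_cfc_le (by positivity) fun r hr => ?_
    have hr' := hsub hr
    exact (hp (1 - r) ⟨by linarith [hr'.2], by linarith [hr'.1]⟩).le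
  have e : D (cfc f V.resolvent x) - cfc (fun r => f (1 - r)) V.resolvent (D x) =
      D ((cfc f V.resolvent - Polynomial.aeval V.resolvent p) x) +
      (Polynomial.aeval (1 - V.resolvent) p - cfc (fun r => f (1 - r)) V.resolvent) (D x) := by
    rw [sub_apply, sub_apply, map_sub, aeval_intertwine hD]
    abel
  have n1 := D.le_opNorm_of_le
    ((cfc f V.resolvent - Polynomial.aeval V.resolvent p).le_of_opNorm_le b1 x)
  have n2 := (Polynomial.aeval (1 - V.resolvent) p -
    cfc (fun r => f (1 - r)) V.resolvent).le_of_opNorm_le b2 (D x)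
  have hpos : 0 < ε / C := div_pos hε hC
  rw [e, zero_add]
  calc _ ≤ ‖D‖ * (ε / C * ‖x‖) + ε / C * ‖D x‖ := (norm_add_le _ _).trans (add_le_add n1 n2)
    _ ≤ ε / C * C := by rw [hCdef]; nlinarith
    _ = ε := by field_simp

/-- An antilinear operator that intertwines `R` and `1 - R` commutes with the modular group. -/
theorem modularPow_comm_of_intertwine {D : H →L[ℝ] H} (hI : ∀ x, D (I • x) = -(I • D x))
    (hD : ∀ x, D (V.resolvent x) = (1 - V.resolvent) (D x)) (t : ℝ) (x : H) :
    D (V.modularPow t x) = V.modularPow t (D x) := by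
  have hsa := V.isSelfAdjoint_resolvent
  have hsub := V.spectrum_real_resolvent_subset
  set T : H →L[ℂ] H := V.resolvent * (1 - V.resolvent) with hT
  have hcont : ContinuousOn (fun r : ℝ => powSymbol t r) (Set.Icc 0 1) := by
    have h := (continuousOn_logSymbol (f := fun s => Complex.exp (I * t * s)) (by fun_prop)
      (C := 1) fun s => by rw [Complex.norm_exp]; simp).comp
      (f := fun r : ℝ => (r : ℂ)) (s := Set.Icc (0 : ℝ) 1) (by fun_prop)
      fun r hr => Set.mem_image_of_mem _ hr
    exact h.congr fun r hr => powSymbol_eq_logSymbol t hr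
  set u : ℝ → ℝ := fun r => (powSymbol t r).re
  set v : ℝ → ℝ := fun r => (powSymbol t r).im
  have hu : ContinuousOn u (Set.Icc 0 1) := Complex.continuous_re.comp_continuousOn hcont
  have hv : ContinuousOn v (Set.Icc 0 1) := Complex.continuous_im.comp_continuousOn hcont
  -- Replacing `r` by `1 - r` inverts `l = (1 - r) / r`, hence conjugates `l ^ (it)`. So `u` is even
  -- and `v` odd under this reflection.
  have hsymm : ∀ r ∈ Set.Icc (0 : ℝ) 1,
      powSymbol t ((1 - r : ℝ) : ℂ) = starRingEnd ℂ (powSymbol t r) := by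
    intro r hr
    rw [powSymbol_eq_logSymbol t hr,
      powSymbol_eq_logSymbol t ⟨by linarith [hr.2], by linarith [hr.1]⟩]
    have e : Real.log ((1 - (1 - r)) / (1 - r)) = -Real.log ((1 - r) / r) := by
      rw [← Real.log_inv, inv_div, sub_sub_cancel]
    simp only [logSymbol, Complex.ofReal_re, e, map_mul, map_sub, map_one, Complex.conj_ofReal,
      ← Complex.exp_conj, Complex.conj_I]
    push_cast
    ring_nf
  have hdec : V.modularPow t * T = cfc u V.resolvent + I • cfc v V.resolvent := by
    have c1 : ContinuousOn (fun z : ℂ => (u z.re : ℂ)) (spectrum ℂ V.resolvent) := by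
      refine Complex.continuous_ofReal.comp_continuousOn
        (hu.comp Complex.continuous_re.continuousOn ?_)
      rintro _ hz
      obtain ⟨r, hr, rfl⟩ := V.spectrum_resolvent hz
      simpa using hr
    have c2 : ContinuousOn (fun z : ℂ => (v z.re : ℂ)) (spectrum ℂ V.resolvent) := by
      refine Complex.continuous_ofReal.comp_continuousOn
        (hv.comp Complex.continuous_re.continuousOn ?_)
      rintro _ hz
      obtain ⟨r, hr, rfl⟩ := V.spectrum_resolvent hz
      simpa using hr
    rw [modularPow_mul, cfc_real_eq_complex, cfc_real_eq_complex, ← cfc_smul I _ V.resolvent c2]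
    refine Eq.trans ?_ (cfc_add V.resolvent _ _ c1 (c2.const_smul I))
    refine cfc_congr fun z hz => ?_
    obtain ⟨r, hr, rfl⟩ := V.spectrum_resolvent hz
    simp only [Complex.ofReal_re, smul_eq_mul, u, v]
    rw [mul_comm I, Complex.re_add_im]
  have hDT : ∀ y, D (T y) = T (D y) := by
    intro y
    have h1 : T = (1 - V.resolvent) * V.resolvent := by rw [hT]; noncomm_ring
    have h2 : T (D y) = (1 - V.resolvent) (V.resolvent (D y)) :=
      congrArg (fun B : H →L[ℂ] H => B (D y)) h1
    change D (V.resolvent (y - V.resolvent y)) = T (D y)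
    rw [hD, map_sub, hD, h2]
    congr 1
    rw [sub_apply]
    exact sub_sub_cancel _ _
  have hDu : ∀ y, D (cfc u V.resolvent y) = cfc u V.resolvent (D y) := by
    intro y
    rw [V.cfc_intertwine hD hu]
    congr 1
    refine cfc_congr fun r hr => ?_
    simp only [u, hsymm r (hsub hr), Complex.conj_re]
  have hDv : ∀ y, D (cfc v V.resolvent y) = -cfc v V.resolvent (D y) := by
    intro y
    rw [V.cfc_intertwine hD hv, ← neg_apply, ← cfc_neg]
    congr 1
    refine cfc_congr fun r hr => ?_
    simp only [v, hsymm r (hsub hr), Complex.conj_im]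
  have key : ∀ y, D (V.modularPow t (T y)) = V.modularPow t (D (T y)) := by
    intro y
    have h1 : ∀ w, V.modularPow t (T w) = cfc u V.resolvent w + I • cfc v V.resolvent w :=
      fun w => congrArg (fun B : H →L[ℂ] H => B w) hdec
    -- The sign from the odd part `v` cancels the sign from moving `i` through the antilinear `D`.
    rw [hDT, h1, h1, map_add, hI, hDu, hDv, smul_neg, neg_neg]
  refine congrFun (V.denseRange_resolvent_mul.equalizer
    (D.continuous.comp (V.modularPow t).continuous)
    ((V.modularPow t).continuous.comp D.continuous) ?_) x
  funext y
  exact key y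

end Antilinear

/-! ### Orthogonality, invariance and direct sums -/

section DirectSumIff

variable {H : Type*} [NormedAddCommGroup H] [InnerProductSpace ℂ H]

theorem mem_inf_orthogonal_iff {V V₁ : ClosedSubmodule ℝ H} {x : H} :
    x ∈ V ⊓ V₁ᗮ ↔ x ∈ V ∧ ∀ w ∈ V₁, (inner ℂ w x).re = 0 := Iff.rfl

theorem inner_eq_zero_of_inner_I_smul {x y : H} (h : inner ℂ (I • x) y = 0) :
    inner ℂ x y = 0 := by
  rw [inner_smul_left] at h
  simpa using h

theorem inner_I_smul_eq_zero {x y : H} (hre : (inner ℂ x y).re = 0) (him : (inner ℂ x y).im = 0) :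
    inner ℂ (I • x) y = 0 := by
  rw [inner_smul_left, Complex.ext (z := inner ℂ x y) (w := 0) hre him, mul_zero]

/-- The real part of `⟪x, y⟫` vanishes by the choice of `V₂`, so vanishing of the imaginary part is
full complex orthogonality. -/
theorem le_symplComp_iff_inner_I_smul {V V₁ V₂ : ClosedSubmodule ℝ H} (h₂ : V₂ = V ⊓ V₁ᗮ) :
    V₁ ≤ V₂.symplComp ↔ ∀ x ∈ V₁, ∀ y ∈ V₂, inner ℂ (I • x) y = 0 := by
  subst h₂
  constructor
  · intro h x hx y hy
    have h1 := ClosedSubmodule.mem_symplComp_iff.1 (h hx) y hy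
    rw [← inner_conj_symm, Complex.conj_im, neg_eq_zero] at h1
    exact inner_I_smul_eq_zero ((mem_inf_orthogonal_iff.1 hy).2 x hx) h1
  · intro h x hx
    refine ClosedSubmodule.mem_symplComp_iff.2 fun y hy => ?_
    rw [← inner_conj_symm, inner_eq_zero_of_inner_I_smul (h x hx y hy), map_zero, Complex.zero_im]

theorem IsDirectSum.inner_I_smul_eq_zero {V : StandardSubspace H} {V₁ V₂ : ClosedSubmodule ℝ H}
    (h : V.IsDirectSum V₁ V₂) {x y : H} (hx : x ∈ V₁) (hy : y ∈ V₂) :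
    inner ℂ (I • x) y = 0 := by
  obtain ⟨H₁, H₂, W₁, W₂, rfl, h1, h2, -⟩ := h
  have hx' : x ∈ (V₁ : Set H) := hx
  have hy' : y ∈ (V₂ : Set H) := hy
  rw [h1] at hx'
  rw [h2] at hy'
  obtain ⟨x, -, rfl⟩ := hx'
  obtain ⟨y, -, rfl⟩ := hy'
  exact (ClosedSubmodule.mem_orthogonal _ _).1 y.2 _ (H₁.toSubmodule.smul_mem I x.2)

variable [CompleteSpace H]

theorem sub_realProj_mem_inf_orthogonal {V V₁ : ClosedSubmodule ℝ H} (h₁ : V₁ ≤ V) {x : H}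
    (hx : x ∈ V) : x - realProj V₁ x ∈ V ⊓ V₁ᗮ :=
  mem_inf_orthogonal_iff.2 ⟨V.toSubmodule.sub_mem hx (h₁ (realProj_mem V₁ x)), fun w hw => by
    rw [inner_sub_right, Complex.sub_re, re_inner_realProj V₁ hw, sub_self]⟩

theorem realProj_eq_add {V V₁ V₂ : ClosedSubmodule ℝ H} (h₁ : V₁ ≤ V) (h₂ : V₂ = V ⊓ V₁ᗮ) (x : H) :
    realProj V x = realProj V₁ x + realProj V₂ x := by
  subst h₂
  have h3 : realProj V₁ (realProj V x) = realProj V₁ x :=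
    realProj_eq V₁ (realProj_mem V₁ x) fun w hw => by
      rw [re_inner_realProj V₁ hw, re_inner_realProj V (h₁ hw)]
  have h := sub_realProj_mem_inf_orthogonal h₁ (realProj_mem V x)
  rw [h3] at h
  rw [realProj_eq _ h fun w hw => ?_]
  · abel
  · obtain ⟨hw1, hw2⟩ := mem_inf_orthogonal_iff.1 hw
    have h4 := inner_re_symm (𝕜 := ℂ) w (realProj V₁ x)
    have h5 : (inner ℂ w (realProj V₁ x)).re = 0 := h4.trans (hw2 _ (realProj_mem V₁ x))
    rw [inner_sub_right, Complex.sub_re, re_inner_realProj V hw1, h5, sub_zero]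

variable {V : StandardSubspace H} {V₁ V₂ : ClosedSubmodule ℝ H}

theorem resolvent_apply (V : StandardSubspace H) (x : H) :
    V.resolvent x = (2⁻¹ : ℝ) • projAdd V.toClosedSubmodule x := by
  rw [← two_smul_resolvent, smul_smul]
  norm_num

/-- If `i V₁ ⊥ V₂`, then the modular group leaves `V₁` invariant. -/
theorem modularPow_mem_of_inner_I_smul (h₁ : V₁ ≤ V.toClosedSubmodule)
    (h₂ : V₂ = V.toClosedSubmodule ⊓ V₁ᗮ)
    (h : ∀ x ∈ V₁, ∀ y ∈ V₂, inner ℂ (I • x) y = 0) (t : ℝ) {x : H} (hx : x ∈ V₁) :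
    V.modularPow t x ∈ V₁ := by
  have h' : ∀ y ∈ V₂, ∀ x ∈ V₁, inner ℂ y x = 0 := fun y hy x hx => by
    rw [← inner_conj_symm, inner_eq_zero_of_inner_I_smul (h x hx y hy), map_zero]
  have a1 : ∀ x, realProj V₁ (realProj V₂ x) = 0 := fun x => realProj_eq_zero V₁ fun w hw => by
    rw [inner_eq_zero_of_inner_I_smul (h w hw _ (realProj_mem V₂ x)), Complex.zero_re]
  have a2 : ∀ x, realProj V₁ (I • realProj V₂ x) = 0 := fun x =>
    realProj_eq_zero V₁ fun w hw => by
      rw [inner_smul_right, inner_eq_zero_of_inner_I_smul (h w hw _ (realProj_mem V₂ x)),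
        mul_zero, Complex.zero_re]
  have b1 : ∀ x, realProj V₂ (realProj V₁ x) = 0 := fun x => realProj_eq_zero V₂ fun w hw => by
    rw [h' w hw _ (realProj_mem V₁ x), Complex.zero_re]
  have b2 : ∀ x, realProj V₂ (I • realProj V₁ x) = 0 := fun x =>
    realProj_eq_zero V₂ fun w hw => by
      rw [inner_smul_right, h' w hw _ (realProj_mem V₁ x), mul_zero, Complex.zero_re]
  have hadd : ∀ x, projAdd V.toClosedSubmodule x = projAdd V₁ x + projAdd V₂ x := fun x => by
    simp only [projAdd_apply, realProj_eq_add h₁ h₂, smul_add]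
    abel
  -- Complex orthogonality of `V₁` and `V₂` makes their projections, also those onto `iV₁` and
  -- `iV₂`, annihilate each other; only the `V₁` part of `2R` then meets `S₁` and `D₁`.
  have c1 : ∀ x, projAdd V₁ (projAdd V₂ x) = 0 := fun x => by
    simp [projAdd_apply, a1, a2, smul_sub, I_smul_I_smul]
  have c2 : ∀ x, projAdd V₂ (projAdd V₁ x) = 0 := fun x => by
    simp [projAdd_apply, b1, b2, smul_sub, I_smul_I_smul]
  have c3 : ∀ x, projSub V₁ (projAdd V₂ x) = 0 := fun x => by
    simp [projAdd_apply, projSub_apply, a1, a2, smul_sub, I_smul_I_smul]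
  have c4 : ∀ x, projAdd V₂ (projSub V₁ x) = 0 := fun x => by
    simp [projAdd_apply, projSub_apply, b1, b2, smul_add, I_smul_I_smul]
  have hcomm : Commute (projAdd V₁) V.resolvent := by
    ext x
    change projAdd V₁ (V.resolvent x) = V.resolvent (projAdd V₁ x)
    rw [resolvent_apply, resolvent_apply, hadd, hadd, ← Complex.coe_smul, map_smul,
      Complex.coe_smul, map_add, c1, c2]
  have hD : ∀ x, projSub V₁ (V.resolvent x) = (1 - V.resolvent) (projSub V₁ x) := fun x => by
    rw [sub_apply, resolvent_apply, resolvent_apply, hadd, hadd, map_smul, map_add, c3, c4,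
      projSub_projAdd, add_zero, add_zero, smul_sub, smul_smul]
    norm_num
  have k1 : projAdd V₁ (V.modularPow t x) = V.modularPow t (projAdd V₁ x) :=
    congrArg (fun B : H →L[ℂ] H => B x) (V.commute_modularPow_of_commute_resolvent hcomm t).eq
  have k2 := V.modularPow_comm_of_intertwine (projSub_I_smul V₁) hD t x
  have k3 : realProj V₁ (V.modularPow t x) = V.modularPow t x := by
    have h2 : (2 : ℝ) • realProj V₁ (V.modularPow t x) = (2 : ℝ) • V.modularPow t x := by
      rw [two_smul_realProj, k1, k2, ← map_add, ← two_smul_realProj, realProj_of_mem V₁ hx,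
        ← Complex.coe_smul, map_smul, Complex.coe_smul]
    exact smul_right_injective H (two_ne_zero (α := ℝ)) h2
  rw [← k3]
  exact realProj_mem _ _

/-- If the modular group leaves `V₁` invariant, then `i V₁ ⊥ V₂`. -/
theorem inner_I_smul_eq_zero_of_modularPow_mem (h₁ : V₁ ≤ V.toClosedSubmodule)
    (h₂ : V₂ = V.toClosedSubmodule ⊓ V₁ᗮ) (h : ∀ t : ℝ, ∀ x ∈ V₁, V.modularPow t x ∈ V₁)
    {x y : H} (hx : x ∈ V₁) (hy : y ∈ V₂) : inner ℂ (I • x) y = 0 := by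
  -- `V₁` is invariant under `Δ ^ (it)` and under its adjoint `Δ ^ (-it)`, so the projection
  -- commutes.
  have hP : ∀ t z, realProj V₁ (V.modularPow t z) = V.modularPow t (realProj V₁ z) :=
    fun t z => realProj_eq V₁ (h t _ (realProj_mem V₁ z)) fun w hw => by
      have e : ∀ v, inner ℂ w (V.modularPow t v) = inner ℂ (V.modularPow (-t) w) v := fun v => by
        rw [← V.star_modularPow, ContinuousLinearMap.star_eq_adjoint,
          ContinuousLinearMap.adjoint_inner_left]
      rw [e, e, re_inner_realProj V₁ (h (-t) w hw)]
  have hC : ∀ t, Commute (projAdd V₁) (V.modularPow t) := fun t => by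
    ext z
    change projAdd V₁ (V.modularPow t z) = V.modularPow t (projAdd V₁ z)
    rw [projAdd_apply, projAdd_apply, map_sub, map_smul (V.modularPow t) I, ← hP, ← hP,
      map_smul (V.modularPow t) I]
  have hR := V.commute_resolvent_of_commute_modularPow hC
  subst h₂
  obtain ⟨hyV, hy1⟩ := mem_inf_orthogonal_iff.1 hy
  have hcomm : projAdd V₁ (projAdd V.toClosedSubmodule y) =
      projAdd V.toClosedSubmodule (projAdd V₁ y) := by
    have e : projAdd V₁ (V.resolvent y) = V.resolvent (projAdd V₁ y) :=
      congrArg (fun B : H →L[ℂ] H => B y) hR.eq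
    rw [← two_smul_resolvent, ← two_smul_resolvent, ← e, ← Complex.coe_smul, map_smul,
      Complex.coe_smul]
  set P := realProj V₁
  set Q := realProj V.toClosedSubmodule
  have hPy : P y = 0 := realProj_eq_zero V₁ hy1
  have hQy : Q y = y := realProj_of_mem _ hyV
  have hPQ : ∀ z, P (Q z) = P z := fun z => realProj_eq V₁ (realProj_mem V₁ z) fun w hw => by
    rw [re_inner_realProj V₁ hw, re_inner_realProj _ (h₁ hw)]
  have hQP : ∀ z, Q (P z) = P z := fun z => realProj_of_mem _ (h₁ (realProj_mem V₁ z))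
  have hPP : ∀ z, P (P z) = P z := fun z => realProj_of_mem _ (realProj_mem V₁ z)
  have hI : ∀ z : H, I • I • z = -z := I_smul_I_smul
  have e1 : P (I • Q (I • y)) = Q (I • P (I • y)) - I • P (I • y) := by
    simp only [projAdd_apply] at hcomm
    change P (Q y - I • Q (I • y)) - I • P (I • (Q y - I • Q (I • y))) =
      Q (P y - I • P (I • y)) - I • Q (I • (P y - I • P (I • y))) at hcomm
    simp only [hQy, hPy, smul_sub, map_sub, hI, hPQ, hQP, map_neg, smul_neg, smul_zero, map_zero]
      at hcomm
    rw [← sub_eq_zero] at hcomm ⊢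
    rw [← neg_eq_zero, ← hcomm]
    abel
  -- `P` fixes the left side of `e1` and, since `P Q = P`, kills the right side.
  have e2 : P (I • Q (I • y)) = 0 := by
    have := congrArg P e1
    rwa [hPP, map_sub, hPQ, sub_self] at this
  have e3 : I • P (I • y) ∈ V.toClosedSubmodule := by
    rw [e2] at e1
    rw [← sub_eq_zero.1 e1.symm]
    exact realProj_mem _ _
  have e4 : P (I • y) = 0 :=
    V.eq_zero_of_mem_of_I_smul_mem (h₁ (realProj_mem V₁ _)) e3
  refine inner_I_smul_eq_zero (hy1 x hx) ?_
  have e5 := re_inner_realProj V₁ hx (I • y)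
  change (inner ℂ x (P (I • y))).re = _ at e5
  rw [e4, inner_zero_right, inner_smul_right, Complex.I_mul_re] at e5
  simpa using e5.symm

/-- Separation is inherited from `V`. A vector real orthogonal to `W + iW` is complex orthogonal to
`W`, so `hK` makes the orthogonal complement trivial, which is density in `K`. -/
theorem exists_standardSubspace_of_mem (K : ClosedSubmodule ℂ H) (W : ClosedSubmodule ℝ H)
    (hW : W ≤ V.toClosedSubmodule) (hWK : ∀ x ∈ W, x ∈ K)
    (hK : ∀ x ∈ K, (∀ w ∈ W, inner ℂ w x = 0) → x = 0) :
    ∃ W' : StandardSubspace K.toSubmodule,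
      (W : Set H) = Subtype.val '' (W'.toClosedSubmodule : Set K.toSubmodule) := by
  let U : ClosedSubmodule ℝ K.toSubmodule := W.comap (K.toSubmodule.subtypeL.restrictScalars ℝ)
  have hU : ∀ x, x ∈ U ↔ (x : H) ∈ W := fun x => Iff.rfl
  have hUI : ∀ x, x ∈ U → I • x ∈ U.mulI := fun x hx =>
    (ClosedSubmodule.mem_mapEquiv_iff' (scalarSMulCLE K.toSubmodule UnitI) _ x).2 hx
  have hcs : CompleteSpace K.toSubmodule := K.isClosed.completeSpace_coe
  refine ⟨⟨U, ?_, ?_⟩, ?_⟩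
  · refine eq_bot_iff.2 fun x hx => ?_
    obtain ⟨h1, h2⟩ := hx
    obtain ⟨y, hy, rfl⟩ := h2
    have h3 : (y : H) = 0 := V.eq_zero_of_mem_of_I_smul_mem (hW hy) (hW h1)
    have h4 : y = 0 := Subtype.ext h3
    rw [h4]
    exact map_zero (scalarSMulCLE K.toSubmodule UnitI)
  · have h0 : (U ⊔ U.mulI)ᗮ = ⊥ := by
      refine eq_bot_iff.2 fun x hx => ?_
      have hl : U ≤ U ⊔ U.mulI := fun y hy =>
        ClosedSubmodule.mem_sup.2 (subset_closure (Submodule.mem_sup_left hy))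
      have hr : U.mulI ≤ U ⊔ U.mulI := fun y hy =>
        ClosedSubmodule.mem_sup.2 (subset_closure (Submodule.mem_sup_right hy))
      refine Subtype.ext (hK x x.2 fun w hw => ?_)
      have h1 : (inner ℂ w (x : H)).re = 0 := hx ⟨w, hWK w hw⟩ (hl hw)
      have h2 : (inner ℂ (I • w) (x : H)).re = 0 :=
        hx (I • ⟨w, hWK w hw⟩) (hr (hUI _ hw))
      rw [inner_smul_left] at h2
      refine Complex.ext h1 ?_
      simpa using h2
    rw [← ClosedSubmodule.orthogonal_orthogonal_eq (U ⊔ U.mulI), h0,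
      ClosedSubmodule.bot_orthogonal_eq_top]
  · ext x
    constructor
    · exact fun hx => ⟨⟨x, hWK x hx⟩, hx, rfl⟩
    · rintro ⟨y, hy, rfl⟩
      exact hy

theorem isDirectSum_of_inner_I_smul (h₁ : V₁ ≤ V.toClosedSubmodule)
    (h₂ : V₂ = V.toClosedSubmodule ⊓ V₁ᗮ)
    (h : ∀ x ∈ V₁, ∀ y ∈ V₂, inner ℂ (I • x) y = 0) : V.IsDirectSum V₁ V₂ := by
  have h2V : V₂ ≤ V.toClosedSubmodule := h₂ ▸ inf_le_left
  set K : ClosedSubmodule ℂ H := (Submodule.span ℂ (V₁ : Set H)).closure with hKdef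
  have hV₁K : ∀ x ∈ V₁, x ∈ K := fun x hx => subset_closure (Submodule.subset_span hx)
  have hKo : ∀ z, z ∈ Kᗮ ↔ ∀ x ∈ V₁, inner ℂ x z = 0 := by
    intro z
    rw [hKdef, ClosedSubmodule.orthogonal_closure']
    constructor
    · exact fun hz x hx => hz x (Submodule.subset_span hx)
    · intro hz u hu
      induction hu using Submodule.span_induction with
      | mem u hu => exact hz u hu
      | zero => exact inner_zero_left _
      | add u v _ _ hu hv => rw [inner_add_left, hu, hv, add_zero]
      | smul c u _ hu => rw [inner_smul_left, hu, mul_zero]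
  have hV₂K : ∀ y ∈ V₂, y ∈ Kᗮ := fun y hy =>
    (hKo y).2 fun x hx => inner_eq_zero_of_inner_I_smul (h x hx y hy)
  have hsup : V.toClosedSubmodule.toSubmodule = V₁.toSubmodule ⊔ V₂.toSubmodule := by
    refine le_antisymm (fun x hx => ?_) (sup_le h₁ h2V)
    refine Submodule.mem_sup.2 ⟨_, realProj_mem V₁ x, x - realProj V₁ x, ?_, by abel⟩
    rw [h₂]
    exact sub_realProj_mem_inf_orthogonal h₁ hx
  obtain ⟨W₁, hW₁⟩ := exists_standardSubspace_of_mem K V₁ h₁ hV₁K fun x hx hx0 => by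
    have h3 := (ClosedSubmodule.mem_orthogonal _ _).1 ((hKo x).2 hx0) x hx
    exact inner_self_eq_zero.1 h3
  -- A vector of `Kᗮ` orthogonal to `V₂` is orthogonal to `V₁ + V₂ = V`, hence to the dense `V +
  -- iV`.
  obtain ⟨W₂, hW₂⟩ := exists_standardSubspace_of_mem Kᗮ V₂ h2V hV₂K fun x hx hx0 => by
    have h3 : ∀ v ∈ V.toClosedSubmodule, inner ℂ v x = 0 := by
      intro v hv
      obtain ⟨a, ha, b, hb, rfl⟩ := Submodule.mem_sup.1 (hsup ▸ hv :
        v ∈ V₁.toSubmodule ⊔ V₂.toSubmodule)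
      rw [inner_add_left, (hKo x).1 hx a ha, hx0 b hb, add_zero]
    refine V.dense_tomitaDomain.eq_zero_of_inner_right ℂ fun u hu => ?_
    obtain ⟨v, hv, w, hw, rfl⟩ := hu
    rw [inner_add_left, inner_smul_left, h3 v hv, h3 w hw, mul_zero, add_zero]
  exact ⟨K, Kᗮ, W₁, W₂, rfl, hW₁, hW₂, hsup⟩

theorem IsDirectSum.eq_of_standard (h₁ : V₁ ≤ V.toClosedSubmodule)
    (h₂ : V₂ = V.toClosedSubmodule ⊓ V₁ᗮ) (h : V.IsDirectSum V₁ V₂) {W : StandardSubspace H}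
    (hW : W.toClosedSubmodule = V₁) : V.toClosedSubmodule = V₁ := by
  refine le_antisymm (fun x hx => ?_) h₁
  have hz : x - realProj V₁ x ∈ V₂ := h₂ ▸ sub_realProj_mem_inf_orthogonal h₁ hx
  have h0 : x - realProj V₁ x = 0 := by
    refine W.dense_tomitaDomain.eq_zero_of_inner_right ℂ fun u hu => ?_
    obtain ⟨v, hv, w, hw, rfl⟩ := hu
    rw [hW] at hv hw
    rw [inner_add_left, h.inner_I_smul_eq_zero hw hz,
      inner_eq_zero_of_inner_I_smul (h.inner_I_smul_eq_zero hv hz), add_zero]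
  rw [sub_eq_zero.1 h0]
  exact realProj_mem V₁ x

end DirectSumIff

end StandardSubspace

theorem lemma3p5 {H : Type*} [NormedAddCommGroup H] [InnerProductSpace ℂ H] [CompleteSpace H]
    (V : StandardSubspace H) (V₁ V₂ : ClosedSubmodule ℝ H) (h₁ : V₁ ≤ V.toClosedSubmodule)
    (h₂ : V₂ = V.toClosedSubmodule ⊓ V₁ᗮ) :
    [ V.IsDirectSum V₁ V₂,
      V₁ ≤ V₂.symplComp,
      ∀ x ∈ V₁, ∀ y ∈ V₂, inner ℂ (Complex.I • x) y = 0,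
      ∀ t : ℝ, ∀ x ∈ V₁, V.modularPow t x ∈ V₁ ].TFAE ∧
    (V.IsDirectSum V₁ V₂ → (∃ W : StandardSubspace H, W.toClosedSubmodule = V₁) →
      V.toClosedSubmodule = V₁) := by
  refine ⟨?_, fun h ⟨W, hW⟩ => h.eq_of_standard h₁ h₂ hW⟩
  tfae_have 1 → 3 := fun h x hx y hy => h.inner_I_smul_eq_zero hx hy
  tfae_have 3 → 1 := StandardSubspace.isDirectSum_of_inner_I_smul h₁ h₂
  tfae_have 2 ↔ 3 := StandardSubspace.le_symplComp_iff_inner_I_smul h₂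
  tfae_have 3 → 4 := fun h t x hx =>
    StandardSubspace.modularPow_mem_of_inner_I_smul h₁ h₂ h t hx
  tfae_have 4 → 3 := fun h x hx y hy =>
    StandardSubspace.inner_I_smul_eq_zero_of_modularPow_mem h₁ h₂ h hx hy
  tfae_finish
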